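/- **The Column Lemma.** Fix $n\ge 0$, a permutation $\sigma$ of $[n]=\{1,\dots,n\}$ (whose elements are called colours), an integer $m\ge 0$, a commutative ring and an element $x_c$ of it (for instance a variable of a polynomial ring). *Labels.* The edge labels are $0$, $+$, and, for colours $b,f,g\in[n]$, the labels $b$, $b^+$, $fg$, $fg^+$. *Tiles.* All tiles are unit rhombi with labelled edges. Right-sheared tiles have two horizontal edges and two edges of direction $/$; left-sheared tiles have two horizontal edges and two edges of direction $\backslash$; both are written $(\text{left},\text{bottom},\text{right},\text{top})$. Diamond tiles have edges of directions $/$ (NW and SE) and $\backslash$ (SW and NE). Below $f,g,i,j$ range over $[n]$ with $i\le j$ and $\sigma(f)<\sigma(g)$. - Right-sheared tiles of weight $1$: $(0,0,0,0)$, $(i,i,0,0)$, $(0,0,i,i)$, $(j,j,i,i)$, $(g,f,g,f)$, $(0,+,0,+)$, $(i,+,i,+)$, $(i^+,i,0,+)$, $(0,+,i^+,i)$, $(j^+,j,i^+,i)$, $(g^+,f,g^+,f)$. Right-sheared tiles of weight $x_c$: $(0,i,0,i)$. - Left-sheared tiles of weight $1$: $(0,0,0,0)$, $(0,i,0,i)$,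 $(+,i,+,i)$, $(+,0,0,+)$, $(0,+,+,0)$, $(+,+,+,+)$, $(i^+,i,0,+)$, $(0,+,i^+,i)$. Left-sheared tile of weight $-x_c$: $(0,+,0,+)$. - Diamond tiles, all of weight $1$: let $T$ be the set of triples $(0,0,0)$, $(i,i,0)$, $(i^+,i,+)$, $(0,+,+)$, $(i,+,i^+)$, $(g,f,fg)$, $(g^+,f,fg^+)$ (the labels on the edges of directions $/$, horizontal, $\backslash$ of the unit triangles into which the right-sheared tiles of weight $1$ are cut by their short diagonals). A diamond with labels $\mathrm{SW},\mathrm{SE},\mathrm{NW},\mathrm{NE}$ is a tile if and only if there is a label $h$ with $(\mathrm{NW},h,\mathrm{NE})\in T$ and $(\mathrm{SE},h,\mathrm{SW})\in T$. *Banned adjacencies.* If the NE edge of a diamond $A$ is the SW edge of a diamond $B$, with common label $e$, then for colours $i<j$ it is forbidden that $(\mathrm{NW}(A),e,\mathrm{SE}(B))$ equals $(i,0,j)$ or $(i^+,+,j^+)$. There is no such restriction between tiles that are not both diamonds. *Columns.* Consider the hexagon with horizontal sides of length $1$, sides of direction $/$ of length $m$ and sides of direction $\backslash$ of length $1$. Fix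 labels on its boundary: $s$ on the bottom, $r$ on the SW side, $q_1,\dots,q_m$ on the NW side (from bottom to top), $v$ on the top, $u$ on the NE side, and $t_1,\dots,t_m$ on the SE side (from bottom to top). Cut it into rhombi in two ways: - (left-hand side) a left-sheared tile at the bottom, having the boundary edges $r$ and $s$; on top of it a column of $m$ right-sheared tiles with left edges $q_1,\dots,q_m$ and top edge $v$; and to the right of both a strip of $m$ diamonds with SE edges $t_1,\dots,t_m$ and last NE edge $u$; - (right-hand side) a strip of $m$ diamonds on the left, with first SW edge $r$ and NW edges $q_1,\dots,q_m$; to its right a column of $m$ right-sheared tiles with bottom edge $s$ and right edges $t_1,\dots,t_m$; and on top of both a left-sheared tile having the boundary edges $u$ and $v$. The partition function of either side is the sum, over all ways of placing tiles of the corresponding shapes such that labels agree along common edges and with the boundary and no banned adjacency occurs, of the product of the tile weights. **Claim.** For all labels $q_1,\dots,q_m,r,s,t_1,\dots,t_m,u,v$ with $r,u\in\{0,+\}$, the partition functions of the two sides are equal. -/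

import Mathlib

/-- Edge labels. Colours `1, …, n` are represented by `Fin n`.
`zero` is the empty edge, `plus` is a red line, `blue b` is a blue line of colour `b`,
`bluePlus b` (written `b⁺`) is a blue line `b` and a red line sharing the edge, `cross f g`
(written `fg`) is two blue lines `f`, `g` sharing the edge, and `crossPlus f g` (written `fg⁺`)
is two blue lines and a red line sharing the edge. -/
inductive Label (n : ℕ) : Type
  | zero : Label n
  | plus : Label n
  | blue (b : Fin n) : Label n
  | bluePlus (b : Fin n) : Label n
  | cross (f g : Fin n) : Label n
  | crossPlus (f g : Fin n) : Label n
  deriving DecidableEq, Fintype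

namespace Label

/-- The trivial right-sheared tiles, as `RightTrivial σ left bottom right top`.
A right-sheared tile is a unit rhombus with two horizontal edges and two edges of direction `/`.
Blue lines enter at the bottom or the right and leave at the left or the top. -/
inductive RightTrivial {n : ℕ} (σ : Equiv.Perm (Fin n)) :
    Label n → Label n → Label n → Label n → Prop
  | empty : RightTrivial σ zero zero zero zero
  | turnLeft (i : Fin n) : RightTrivial σ (blue i) (blue i) zero zero
  | turnUp (i : Fin n) : RightTrivial σ zero zero (blue i) (blue i)
  | turnBoth (i j : Fin n) (h : i ≤ j) : RightTrivial σ (blue j) (blue j) (blue i) (blue i)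
  | cross (f g : Fin n) (h : σ f < σ g) : RightTrivial σ (blue g) (blue f) (blue g) (blue f)
  | red : RightTrivial σ zero plus zero plus
  | redCross (i : Fin n) : RightTrivial σ (blue i) plus (blue i) plus
  | turnLeftPlus (i : Fin n) : RightTrivial σ (bluePlus i) (blue i) zero plus
  | turnUpPlus (i : Fin n) : RightTrivial σ zero plus (bluePlus i) (blue i)
  | turnBothPlus (i j : Fin n) (h : i ≤ j) :
      RightTrivial σ (bluePlus j) (blue j) (bluePlus i) (blue i)
  | crossPlus (f g : Fin n) (h : σ f < σ g) :
      RightTrivial σ (bluePlus g) (blue f) (bluePlus g) (blue f)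

/-- The nontrivial right-sheared tiles (`left bottom right top`), of weight `x_c`: a blue line goes
straight from the bottom to the top. -/
inductive RightNontrivial {n : ℕ} : Label n → Label n → Label n → Label n → Prop
  | vertical (i : Fin n) : RightNontrivial zero (blue i) zero (blue i)

/-- The trivial left-sheared tiles, as `LeftTrivial left bottom right top`.
A left-sheared tile is a unit rhombus with two horizontal edges and two edges of direction `\`.
Here blue lines never cross each other. -/
inductive LeftTrivial {n : ℕ} : Label n → Label n → Label n → Label n → Prop
  | empty : LeftTrivial zero zero zero zero
  | blueUp (i : Fin n) : LeftTrivial zero (blue i) zero (blue i)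
  | blueUpRedRight (i : Fin n) : LeftTrivial plus (blue i) plus (blue i)
  | redTurnUp : LeftTrivial plus zero zero plus
  | redTurnRight : LeftTrivial zero plus plus zero
  | redTurnBoth : LeftTrivial plus plus plus plus
  | blueTurnLeft (i : Fin n) : LeftTrivial (bluePlus i) (blue i) zero plus
  | blueTurnUp (i : Fin n) : LeftTrivial zero plus (bluePlus i) (blue i)

/-- The nontrivial left-sheared tile (`left bottom right top`), of weight `-x_c`: a red line goes
straight from the bottom to the top. -/
inductive LeftNontrivial {n : ℕ} : Label n → Label n → Label n → Label n → Prop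
  | vertical : LeftNontrivial zero plus zero plus

/-- The unit triangles obtained by cutting the trivial right-sheared tiles along their short
diagonal (of direction `\`), as `Triangle σ a h d`, where `a`, `h`, `d` are the labels of the edges
of direction `/`, `—`, `\`. The lower left half of a tile is an upward triangle
(`a` left, `h` bottom, `d` right); the upper right half is a downward triangle
(`a` right, `h` top, `d` left). The same labels are allowed for both. -/
inductive Triangle {n : ℕ} (σ : Equiv.Perm (Fin n)) : Label n → Label n → Label n → Prop
  | empty : Triangle σ zero zero zero
  | blue (i : Fin n) : Triangle σ (blue i) (blue i) zero
  | bluePlus (i : Fin n) : Triangle σ (bluePlus i) (blue i) plus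
  | red : Triangle σ zero plus plus
  | redCross (i : Fin n) : Triangle σ (blue i) plus (bluePlus i)
  | cross (f g : Fin n) (h : σ f < σ g) : Triangle σ (blue g) (blue f) (cross f g)
  | crossPlus (f g : Fin n) (h : σ f < σ g) : Triangle σ (bluePlus g) (blue f) (crossPlus f g)

/-- The diamond tiles (all of weight `1`), as `Diamond σ sw se nw ne`: unit rhombi with edges of
directions `\` (south-west and north-east) and `/` (south-east and north-west). They are all the
gluings of an upward triangle on top of a downward triangle along a horizontal edge. -/
def Diamond {n : ℕ} (σ : Equiv.Perm (Fin n)) (sw se nw ne : Label n) : Prop :=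
  ∃ h : Label n, Triangle σ nw h ne ∧ Triangle σ se h sw

/-- The banned adjacencies of two diamonds, the north-east edge of the lower one being the
south-west edge of the upper one. `Banned nw e se`: `nw` is the north-west label of the lower
diamond, `e` the label of the common edge, `se` the south-east label of the upper diamond. A blue
line `i` must not move diagonally directly below a blue line `j` if `i < j`. -/
inductive Banned {n : ℕ} : Label n → Label n → Label n → Prop
  | blue (i j : Fin n) (h : i < j) : Banned (blue i) zero (blue j)
  | bluePlus (i j : Fin n) (h : i < j) : Banned (bluePlus i) plus (bluePlus j)

/-- A legal strip of `m` diamonds going to the north-east: the `k`-th one, counted from the bottom,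
has labels `e k` (SW), `se k` (SE), `nw k` (NW), `e (k + 1)` (NE). -/
def DiamondStrip {n m : ℕ} (σ : Equiv.Perm (Fin n)) (e : Fin (m + 1) → Label n)
    (se nw : Fin m → Label n) : Prop :=
  (∀ k : Fin m, Diamond σ (e k.castSucc) (se k) (nw k) (e k.succ)) ∧
    ∀ k l : Fin m, (l : ℕ) = k + 1 → ¬ Banned (nw k) (e k.succ) (se l)

end Label

open Classical in
/-- Weight of a right-sheared tile with the given labels; `0` if there is no such tile. -/
noncomputable def rightWeight {n : ℕ} {R : Type*} [CommRing R] (σ : Equiv.Perm (Fin n)) (x : R)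
    (left bottom right top : Label n) : R :=
  if Label.RightTrivial σ left bottom right top then 1
  else if Label.RightNontrivial left bottom right top then x
  else 0

open Classical in
/-- Weight of a left-sheared tile with the given labels; `0` if there is no such tile. -/
noncomputable def leftWeight {n : ℕ} {R : Type*} [CommRing R] (x : R)
    (left bottom right top : Label n) : R :=
  if Label.LeftTrivial left bottom right top then 1
  else if Label.LeftNontrivial left bottom right top then -x
  else 0

open Classical in
/-- Weight of a strip of diamonds: `1` if it is legal, `0` otherwise. -/
noncomputable def stripWeight {n m : ℕ} (R : Type*) [CommRing R] (σ : Equiv.Perm (Fin n))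
    (e : Fin (m + 1) → Label n) (se nw : Fin m → Label n) : R :=
  if Label.DiamondStrip σ e se nw then 1 else 0

/-- Partition function of the first tiling of the elongated hexagon whose boundary reads, clockwise
from the bottom edge: `s` (bottom), `r` (SW, direction `\`), `q 0, …, q (m-1)` (NW, direction `/`,
upwards), `v` (top), `u` (NE, direction `\`), and whose SE side, of direction `/`, reads upwards
`t 0, …, t (m-1)`.

A left-sheared tile sits at the bottom (left `r`, bottom `s`), a column of `m` right-sheared tiles
on top of it (left sides `q`, last top `v`), and a strip of `m` diamonds to the right of both
(SE sides `t`, last NE `u`). A tiling is given by the labels of the internal edges: `h` on the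
horizontal edges of the column (`h m = v`), `e` on the edges of direction `\` of the strip
(`e m = u`), and `w` on the edges between the column and the strip. -/
noncomputable def columnLHS {n m : ℕ} {R : Type*} [CommRing R] (σ : Equiv.Perm (Fin n)) (x : R)
    (q : Fin m → Label n) (r s : Label n) (t : Fin m → Label n) (u v : Label n) : R :=
  ∑ h : Fin (m + 1) → Label n, ∑ e : Fin (m + 1) → Label n, ∑ w : Fin m → Label n,
    if h (Fin.last m) = v ∧ e (Fin.last m) = u then
      leftWeight x r s (e 0) (h 0) *
        (∏ k : Fin m, rightWeight σ x (q k) (h k.castSucc) (w k) (h k.succ)) *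
        stripWeight R σ e t w
    else 0

/-- Partition function of the second tiling of the same hexagon: a strip of `m` diamonds on the left
(first SW `r`, NW sides `q`), a column of `m` right-sheared tiles to its right (first bottom `s`,
right sides `t`), and a left-sheared tile on top of both (right `u`, top `v`). -/
noncomputable def columnRHS {n m : ℕ} {R : Type*} [CommRing R] (σ : Equiv.Perm (Fin n)) (x : R)
    (q : Fin m → Label n) (r s : Label n) (t : Fin m → Label n) (u v : Label n) : R :=
  ∑ h : Fin (m + 1) → Label n, ∑ e : Fin (m + 1) → Label n, ∑ w : Fin m → Label n,
    if h 0 = s ∧ e 0 = r then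
      stripWeight R σ e w q *
        (∏ k : Fin m, rightWeight σ x (w k) (h k.castSucc) (t k) (h k.succ)) *
        leftWeight x (e (Fin.last m)) (h (Fin.last m)) u v
    else 0

/-! Both tilings are cut into rows, each consisting of a right-sheared tile and the diamond beside
it. The total weight of the part above a given height depends only on the horizontal label `h` of
the column, the label `e` of the strip and the NW label `M` of the diamond just below; `M` is all
that the banned adjacencies remember. Putting a new row at the bottom applies a linear operator,
`stepLeft` or `stepRight`, so the theorem becomes an induction on the number of rows.

The claim itself is too weak for this induction, because a row leads to states where the strip
carries blue lines or a memory. It is strengthened to the system `Linked` of linear relations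
between the values `L` and `R` of the two tilings. These relations hold above the last row
(`linked_final`), survive every row (`Linked.step`), and contain the claim when the memory bans
nothing.

For the inductive step every diamond is cut along its horizontal diagonal. In the first tiling the
lower triangle is forced by the boundary, and what is left is the sum `upper` over a tile and the
triangle to its right. `upper_blue_blue` and `upper_blue_base` rewrite this sum in terms of `R`,
with one term for each way in which the right-sheared tile of the second tiling can be filled.
`upper_blue_swap` exchanges two horizontal labels and propagates the relations internal to `L`.
`right_plus_turn` treats the red line; there the weight `-x` of the left-sheared tile cancels the
weight `x` of the right-sheared one. -/

namespace Label

variable {n : ℕ} {S : Type*} [CommRing S] (σ : Equiv.Perm (Fin n)) (x : S)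

/-! ### Labels and triangles in families, for case analysis -/

/-- The labels `0` and `+` of the empty and of the red edge. -/
def base : Bool → Label n
  | false => zero
  | true => plus

/-- The labels `b` and `b⁺`. -/
def line : Bool → Fin n → Label n
  | false, i => blue i
  | true, i => bluePlus i

/-- The labels `fg` and `fg⁺`. -/
def pair : Bool → Fin n → Fin n → Label n
  | false, f, g => cross f g
  | true, f, g => crossPlus f g

/-- The label which bans exactly the lines of colour larger than `M`; nothing is banned by `⊤`. -/
def memory (b : Bool) : WithTop (Fin n) → Label n
  | ⊤ => zero
  | (i : Fin n) => line b i

theorem memory_top (b : Bool) : memory b (⊤ : WithTop (Fin n)) = zero := rfl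
theorem memory_coe (b : Bool) (i : Fin n) : memory b (i : WithTop (Fin n)) = line b i := rfl

/-- A label is an element of a disjoint union. -/
def equivSum (n : ℕ) : Label n ≃
    (Unit ⊕ Unit) ⊕ (Fin n ⊕ Fin n) ⊕ ((Fin n × Fin n) ⊕ (Fin n × Fin n)) where
  toFun
    | zero => .inl (.inl ())
    | plus => .inl (.inr ())
    | blue i => .inr (.inl (.inl i))
    | bluePlus i => .inr (.inl (.inr i))
    | cross f g => .inr (.inr (.inl (f, g)))
    | crossPlus f g => .inr (.inr (.inr (f, g)))
  invFun
    | .inl (.inl _) => zero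
    | .inl (.inr _) => plus
    | .inr (.inl (.inl i)) => blue i
    | .inr (.inl (.inr i)) => bluePlus i
    | .inr (.inr (.inl (f, g))) => cross f g
    | .inr (.inr (.inr (f, g))) => crossPlus f g
  left_inv l := by cases l <;> rfl
  right_inv l := by rcases l with (_ | _) | (_ | _) | (_ | _) <;> rfl

theorem sum_eq (F : Label n → S) :
    ∑ l, F l = F zero + F plus + ((∑ i, F (blue i)) + ∑ i, F (bluePlus i)) +
      ((∑ f, ∑ g, F (cross f g)) + ∑ f, ∑ g, F (crossPlus f g)) := by
  rw [← (equivSum n).symm.sum_comp]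
  simp [Fintype.sum_sum_type, Fintype.sum_prod_type, equivSum, add_assoc]

theorem triangle_iff (a h d : Label n) : Triangle σ a h d ↔
    match a, h, d with
    | zero, zero, zero => True
    | zero, plus, plus => True
    | blue i, blue j, zero => i = j
    | bluePlus i, blue j, plus => i = j
    | blue i, plus, bluePlus j => i = j
    | blue g, blue f, cross f' g' => f = f' ∧ g = g' ∧ σ f < σ g
    | bluePlus g, blue f, crossPlus f' g' => f = f' ∧ g = g' ∧ σ f < σ g
    | _, _, _ => False := by
  constructor
  · intro H; cases H <;> simp_all
  · intro H
    split at H <;> first | exact H.elim | skip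
    · exact .empty
    · exact .red
    · subst H; exact .blue _
    · subst H; exact .bluePlus _
    · subst H; exact .redCross _
    · obtain ⟨rfl, rfl, H⟩ := H; exact .cross _ _ H
    · obtain ⟨rfl, rfl, H⟩ := H; exact .crossPlus _ _ H

/-- A diamond therefore has at most one horizontal diagonal, so sums over diamonds can be taken
triangle by triangle without overcounting. -/
theorem triangle_unique {a h h' d : Label n} (H : Triangle σ a h d) (H' : Triangle σ a h' d) :
    h = h' := by
  cases H <;> cases H' <;> rfl

theorem banned_iff (a e c : Label n) : Banned a e c ↔
    match a, e, c with
    | blue i, zero, blue j => i < j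
    | bluePlus i, plus, bluePlus j => i < j
    | _, _, _ => False := by
  constructor
  · intro H; cases H <;> simp_all
  · intro H
    split at H <;> first | exact H.elim | skip
    · exact .blue _ _ H
    · exact .bluePlus _ _ H

/-! ### Tables of the sheared tiles -/

/-- The contribution of a right-sheared tile, summed over its top label. -/
noncomputable def column (q h w : Label n) (V : Label n → S) : S :=
  ∑ h', rightWeight σ x q h w h' * V h'

theorem rightTrivial_iff (l b r t : Label n) : RightTrivial σ l b r t ↔
    match l, b, r, t with
    | zero, zero, zero, zero => True
    | blue i, blue i', zero, zero => i = i'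
    | zero, zero, blue i, blue i' => i = i'
    | blue j, blue j', blue i, blue i' =>
        (j = j' ∧ i = i' ∧ i ≤ j) ∨ (j = i ∧ j' = i' ∧ σ j' < σ j)
    | zero, plus, zero, plus => True
    | blue i, plus, blue i', plus => i = i'
    | bluePlus i, blue i', zero, plus => i = i'
    | zero, plus, bluePlus i, blue i' => i = i'
    | bluePlus j, blue j', bluePlus i, blue i' =>
        (j = j' ∧ i = i' ∧ i ≤ j) ∨ (j = i ∧ j' = i' ∧ σ j' < σ j)
    | _, _, _, _ => False := by
  constructor
  · intro H; cases H <;> simp_all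
  · intro H
    split at H <;> first | exact H.elim | skip
    · exact .empty
    · subst H; exact .turnLeft _
    · subst H; exact .turnUp _
    · obtain ⟨rfl, rfl, H⟩ | ⟨rfl, rfl, H⟩ := H
      · exact .turnBoth _ _ H
      · exact .cross _ _ H
    · exact .red
    · subst H; exact .redCross _
    · subst H; exact .turnLeftPlus _
    · subst H; exact .turnUpPlus _
    · obtain ⟨rfl, rfl, H⟩ | ⟨rfl, rfl, H⟩ := H
      · exact .turnBothPlus _ _ H
      · exact .crossPlus _ _ H

theorem rightNontrivial_iff (l b r t : Label n) : RightNontrivial l b r t ↔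
    match l, b, r, t with
    | zero, blue i, zero, blue i' => i = i'
    | _, _, _, _ => False := by
  constructor
  · intro H; cases H; simp
  · intro H
    split at H <;> first | exact H.elim | skip
    subst H; exact .vertical _

theorem leftTrivial_iff (l b r t : Label n) : LeftTrivial l b r t ↔
    match l, b, r, t with
    | zero, zero, zero, zero => True
    | zero, blue i, zero, blue i' => i = i'
    | plus, blue i, plus, blue i' => i = i'
    | plus, zero, zero, plus => True
    | zero, plus, plus, zero => True
    | plus, plus, plus, plus => True
    | bluePlus i, blue i', zero, plus => i = i'
    | zero, plus, bluePlus i, blue i' => i = i'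
    | _, _, _, _ => False := by
  constructor
  · intro H; cases H <;> simp_all
  · intro H
    split at H <;> first | exact H.elim | skip
    · exact .empty
    · subst H; exact .blueUp _
    · subst H; exact .blueUpRedRight _
    · exact .redTurnUp
    · exact .redTurnRight
    · exact .redTurnBoth
    · subst H; exact .blueTurnLeft _
    · subst H; exact .blueTurnUp _

theorem leftNontrivial_iff (l b r t : Label n) : LeftNontrivial l b r t ↔
    l = zero ∧ b = plus ∧ r = zero ∧ t = plus := by
  constructor
  · intro H; cases H; simp
  · rintro ⟨rfl, rfl, rfl, rfl⟩; exact .vertical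

section column
variable (V : Label n → S) (i j k : Fin n) (b : Bool)

@[simp] theorem column_zero_zero_zero : column σ x zero zero zero V = V zero := by
  simp [column, sum_eq, rightWeight, rightTrivial_iff, rightNontrivial_iff]
@[simp] theorem column_zero_zero_line :
    column σ x zero zero (line b i) V = if b then 0 else V (blue i) := by
  cases b <;> simp [column, sum_eq, rightWeight, rightTrivial_iff, rightNontrivial_iff, line]
@[simp] theorem column_zero_plus_zero : column σ x zero plus zero V = V plus := by
  simp [column, sum_eq, rightWeight, rightTrivial_iff, rightNontrivial_iff]
@[simp] theorem column_zero_plus_line :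
    column σ x zero plus (line b i) V = if b then V (blue i) else 0 := by
  cases b <;> simp [column, sum_eq, rightWeight, rightTrivial_iff, rightNontrivial_iff, line]
@[simp] theorem column_zero_blue_zero : column σ x zero (blue i) zero V = x * V (blue i) := by
  simp [column, sum_eq, rightWeight, rightTrivial_iff, rightNontrivial_iff]
@[simp] theorem column_zero_blue_line :
    column σ x zero (blue i) (line b k) V = 0 := by
  cases b <;> simp [column, rightWeight, rightTrivial_iff, rightNontrivial_iff, line]
@[simp] theorem column_line_zero (w : Label n) :
    column σ x (line b i) zero w V = 0 := by
  cases b <;> simp [column, rightWeight, rightTrivial_iff, rightNontrivial_iff, line]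
@[simp] theorem column_line_plus_zero :
    column σ x (line b i) plus zero V = 0 := by
  cases b <;> simp [column, rightWeight, rightTrivial_iff, rightNontrivial_iff, line]
@[simp] theorem column_line_plus_line (b' : Bool) :
    column σ x (line b i) plus (line b' k) V =
      if b = false ∧ b' = false ∧ i = k then V plus else 0 := by
  cases b <;> cases b' <;>
    simp [column, sum_eq, rightWeight, rightTrivial_iff, rightNontrivial_iff, line]
@[simp] theorem column_line_blue_zero :
    column σ x (line b i) (blue j) zero V = if i = j then V (base b) else 0 := by
  cases b <;> simp [column, sum_eq, rightWeight, rightTrivial_iff, rightNontrivial_iff, line, base]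
@[simp] theorem column_line_blue_line (b' : Bool) :
    column σ x (line b i) (blue j) (line b' k) V =
      if b = b' then (if i = j ∧ k ≤ i then V (blue k) else 0) +
        (if i = k ∧ σ j < σ i then V (blue j) else 0) else 0 := by
  have aux : ∑ a, (if i = j ∧ k = a ∧ k ≤ i ∨ i = k ∧ j = a ∧ σ j < σ i then V (blue a) else 0) =
      (if i = j ∧ k ≤ i then V (blue k) else 0) +
        (if i = k ∧ σ j < σ i then V (blue j) else 0) := by
    by_cases h1 : i = j
    · subst h1
      by_cases h2 : k ≤ i <;> simp [h2]
    · by_cases h2 : i = k ∧ σ j < σ i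
      · obtain ⟨h3, h4⟩ := h2
        subst h3
        simp [h1, h4]
      · simp only [h1, false_and, false_or, if_false, h2, add_zero]
        refine Finset.sum_eq_zero fun a _ => if_neg ?_
        tauto
  cases b <;> cases b' <;>
    simp [column, sum_eq, rightWeight, rightTrivial_iff, rightNontrivial_iff, line, aux]
theorem column_of_ne {h : Label n} (h0 : h ≠ zero) (hp : h ≠ plus) (hb : ∀ i, h ≠ blue i)
    (q w : Label n) : column σ x q h w V = 0 := by
  refine Finset.sum_eq_zero fun h' _ => ?_
  have h1 : ¬ RightTrivial σ q h w h' := fun H => by cases H <;> simp_all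
  have h2 : ¬ RightNontrivial q h w h' := fun H => by cases H; simp_all
  simp [rightWeight, h1, h2]
theorem column_pair_left (f g : Fin n) (h w : Label n) :
    column σ x (pair b f g) h w V = 0 := by
  refine Finset.sum_eq_zero fun h' _ => ?_
  cases b <;> simp [rightWeight, rightTrivial_iff, rightNontrivial_iff, pair]
theorem column_pair_right (f g : Fin n) (q h : Label n) :
    column σ x q h (pair b f g) V = 0 := by
  refine Finset.sum_eq_zero fun h' _ => ?_
  have h1 : ¬ RightTrivial σ q h (pair b f g) h' := fun H => by cases b <;> cases H
  have h2 : ¬ RightNontrivial q h (pair b f g) h' := fun H => by cases b <;> cases H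
  simp [rightWeight, h1, h2]
theorem column_plus_left (h w : Label n) : column σ x plus h w V = 0 := by
  refine Finset.sum_eq_zero fun h' _ => ?_
  simp [rightWeight, rightTrivial_iff, rightNontrivial_iff]
theorem column_plus_right (q h : Label n) : column σ x q h plus V = 0 := by
  refine Finset.sum_eq_zero fun h' _ => ?_
  have h1 : ¬ RightTrivial σ q h plus h' := fun H => by cases H
  have h2 : ¬ RightNontrivial q h plus h' := fun H => by cases H
  simp [rightWeight, h1, h2]
end column

end Label

namespace Label

variable {n : ℕ} {S : Type*} [CommRing S] (σ : Equiv.Perm (Fin n)) (x : S)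

/-! ### Half diamonds and the transfer operators -/

theorem line_false (i : Fin n) : line false i = blue i := rfl
theorem line_true (i : Fin n) : line true i = bluePlus i := rfl
theorem base_false : base false = (zero : Label n) := rfl
theorem base_true : base true = (plus : Label n) := rfl
theorem pair_false (f g : Fin n) : pair false f g = cross f g := rfl
theorem pair_true (f g : Fin n) : pair true f g = crossPlus f g := rfl

@[simp] theorem banned_memory_line (b b' : Bool) (M : WithTop (Fin n)) (i : Fin n) :
    Banned (memory b M) (base b) (line b' i) ↔ b' = b ∧ M < i := by
  induction M using WithTop.recTopCoe with
  | top => simp [banned_iff, memory_top]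
  | coe j => cases b <;> cases b' <;> simp [banned_iff, line, base, memory_coe]

@[simp] theorem not_banned_zero_right (a e : Label n) : ¬ Banned a e zero := by rintro ⟨⟩
@[simp] theorem not_banned_zero_left (a e : Label n) : ¬ Banned zero a e := by rintro ⟨⟩
@[simp] theorem not_banned_bluePlus (a c : Label n) (i : Fin n) : ¬ Banned a (bluePlus i) c := by
  rintro ⟨⟩
@[simp] theorem not_banned_pair (a c : Label n) (b : Bool) (f g : Fin n) :
    ¬ Banned a (pair b f g) c := by
  cases b <;> rintro ⟨⟩

open Classical in
/-- Sum over the third label of a triangle with slanted label `a` and horizontal label `h`. -/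
noncomputable def diagonal (a h : Label n) (F : Label n → S) : S :=
  ∑ e, if Triangle σ a h e then F e else 0

section diagonal
variable (F : Label n → S) (b : Bool) (i j : Fin n)

@[simp] theorem diagonal_zero_base : diagonal σ zero (base b) F = F (base b) := by
  cases b <;> simp [diagonal, sum_eq, base, triangle_iff]
@[simp] theorem diagonal_zero_zero : diagonal σ zero zero F = F zero :=
  diagonal_zero_base σ F false
@[simp] theorem diagonal_zero_plus : diagonal σ zero plus F = F plus :=
  diagonal_zero_base σ F true
@[simp] theorem diagonal_zero_blue : diagonal σ zero (blue i) F = 0 := by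
  simp [diagonal, triangle_iff]
@[simp] theorem diagonal_line_zero : diagonal σ (line b i) zero F = 0 := by
  cases b <;> simp [diagonal, line, triangle_iff]
@[simp] theorem diagonal_line_plus :
    diagonal σ (line b i) plus F = if b then 0 else F (bluePlus i) := by
  cases b <;> simp [diagonal, sum_eq, line, triangle_iff]
@[simp] theorem diagonal_line_blue : diagonal σ (line b j) (blue i) F =
    if j = i then F (base b) else if σ i < σ j then F (pair b i j) else 0 := by
  by_cases h : j = i
  · subst h
    cases b <;> simp [diagonal, sum_eq, line, base, triangle_iff]
  · by_cases h' : σ i < σ j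
    · cases b <;> simp [diagonal, sum_eq, line, pair, triangle_iff, h, h', ite_and]
    · cases b <;> simp [diagonal, sum_eq, line, triangle_iff, h, h']
theorem diagonal_plus (h : Label n) : diagonal σ plus h F = 0 := by
  simp [diagonal, triangle_iff]
theorem diagonal_pair (h : Label n) : diagonal σ (pair b i j) h F = 0 := by
  cases b <;> simp [diagonal, pair, triangle_iff]

theorem diagonal_zero_fun (a h : Label n) : diagonal σ a h (fun _ => (0 : S)) = 0 := by
  simp [diagonal]

theorem diagonal_add (a h : Label n) (G : Label n → S) :
    diagonal σ a h (fun e => F e + G e) = diagonal σ a h F + diagonal σ a h G := by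
  classical
  simp only [diagonal, ← Finset.sum_add_distrib]
  refine Finset.sum_congr rfl fun e _ => ?_
  split_ifs <;> simp

theorem diagonal_ite (a h : Label n) (p : Prop) [Decidable p] :
    diagonal σ a h (fun e => if p then F e else 0) = if p then diagonal σ a h F else 0 := by
  split_ifs <;> simp [diagonal]
end diagonal

/-- Contribution of a right-sheared tile (left `q`, bottom `h`) and of the upper triangle, standing
on `mid`, of the diamond to its right, summed over their common edge. -/
noncomputable def upper (V : Label n → Label n → Label n → S) (q h mid : Label n) : S :=
  ∑ w, diagonal σ w mid fun e => column σ x q h w fun h' => V h' e w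

open Classical in
/-- One step of the transfer operator of the first tiling. The value function `V h e M` depends on
the horizontal label `h`, the label `e` of the strip and the NW label `M` of the last diamond. -/
noncomputable def stepLeft (q t : Label n) (V : Label n → Label n → Label n → S)
    (h e M : Label n) : S :=
  if Banned M e t then 0 else
    ∑ w, ∑ e', if Diamond σ e t w e' then column σ x q h w fun h' => V h' e' w else 0

open Classical in
/-- One step of the transfer operator of the second tiling. -/
noncomputable def stepRight (q t : Label n) (V : Label n → Label n → Label n → S)
    (h e M : Label n) : S :=
  ∑ w, if Banned M e w then 0 else
    ∑ e', if Diamond σ e w q e' then column σ x w h t fun h' => V h' e' q else 0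

open Classical in
-- In the first tiling the lower half of the diamond touches the boundary label `t` and the known
-- label `e`, which fix its diagonal; only the upper half remains to be summed.
theorem stepLeft_of_triangle {t mid e : Label n} (H : Triangle σ t mid e)
    (V : Label n → Label n → Label n → S) (q h M : Label n) :
    stepLeft σ x q t V h e M = if Banned M e t then 0 else upper σ x V q h mid := by
  have : ∀ w e', Diamond σ e t w e' ↔ Triangle σ w mid e' := fun w e' =>
    ⟨fun ⟨m, h1, h2⟩ => triangle_unique σ h2 H ▸ h1, fun h1 => ⟨mid, h1, H⟩⟩
  simp only [stepLeft, this, upper, diagonal]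

theorem stepLeft_of_not_triangle {t e : Label n} (H : ∀ mid, ¬ Triangle σ t mid e)
    (V : Label n → Label n → Label n → S) (q h M : Label n) :
    stepLeft σ x q t V h e M = 0 := by
  have : ∀ w e', ¬ Diamond σ e t w e' := fun w e' ⟨m, _, h2⟩ => H m h2
  simp [stepLeft, this]

open Classical in
-- In the second tiling the inner label `w` lies on the lower half of the diamond and the boundary
-- label `q` on the upper half. Summing over the diagonal is harmless, since `w` and `e` determine
-- it.
theorem stepRight_eq (q t : Label n) (V : Label n → Label n → Label n → S) (h e M : Label n) :
    stepRight σ x q t V h e M = ∑ w, ∑ mid, if Triangle σ w mid e ∧ ¬ Banned M e w then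
        diagonal σ q mid fun e' => column σ x w h t fun h' => V h' e' q else 0 := by
  refine Finset.sum_congr rfl fun w _ => ?_
  split_ifs with hB
  · simp [hB]
  by_cases H : ∃ mid, Triangle σ w mid e
  · obtain ⟨mid, H⟩ := H
    have h1 : ∀ e', Diamond σ e w q e' ↔ Triangle σ q mid e' := fun e' =>
      ⟨fun ⟨m, h1, h2⟩ => triangle_unique σ h2 H ▸ h1, fun h1 => ⟨mid, h1, H⟩⟩
    have h2 : ∀ m, Triangle σ w m e ↔ m = mid := fun m =>
      ⟨fun h => triangle_unique σ h H, fun h => h ▸ H⟩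
    simp [h1, h2, diagonal, hB]
  · have h1 : ∀ e', ¬ Diamond σ e w q e' := fun e' ⟨m, _, h2⟩ => H ⟨m, h2⟩
    push Not at H
    simp [h1, H]

section steps
variable (V : Label n → Label n → Label n → S) (q h t : Label n) (M : WithTop (Fin n))
  (b b' : Bool) (f g i k : Fin n)

@[simp] theorem upper_zero :
    upper σ x V q h zero = column σ x q h zero fun h' => V h' zero zero := by
  simp [upper, diagonal, sum_eq, triangle_iff]
theorem upper_plus :
    upper σ x V q h plus = (column σ x q h zero fun h' => V h' plus zero) +
      ∑ i, column σ x q h (line false i) fun h' => V h' (bluePlus i) (blue i) := by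
  simp [upper, diagonal, sum_eq, line, triangle_iff]
theorem upper_blue :
    upper σ x V q h (blue f) =
      ∑ b : Bool, ((column σ x q h (line b f) fun h' => V h' (base b) (line b f)) +
        ∑ g, if σ f < σ g then
          column σ x q h (line b g) fun h' => V h' (pair b f g) (line b g) else 0) := by
  -- The two conditions exclude each other, so the nested case distinction can be written as a sum.
  have key : ∀ b i j, diagonal σ (line b j) (blue i)
      (fun e => column σ x q h (line b j) fun h' => V h' e (line b j)) =
      (if j = i then column σ x q h (line b i) (fun h' => V h' (base b) (line b i)) else 0) +
      (if σ i < σ j then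
        column σ x q h (line b j) (fun h' => V h' (pair b i j) (line b j)) else 0) := by
    intro b i j
    rw [diagonal_line_blue]
    split_ifs with h1 h2
    · subst h1; exact absurd h2 (lt_irrefl _)
    · subst h1; simp
    · simp
    · simp
  have k0 := key false f
  have k1 := key true f
  simp only [line_false, line_true, base_false, base_true, pair_false, pair_true] at k0 k1
  have kp := fun F : Label n → S => diagonal_plus σ F (blue f)
  have kc := fun (F : Label n → S) b i j => diagonal_pair σ F b i j (blue f)
  have kc0 := fun (F : Label n → S) => kc F false
  have kc1 := fun (F : Label n → S) => kc F true
  simp only [pair_false, pair_true] at kc0 kc1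
  rw [upper, sum_eq]
  simp only [k0, k1, kp, kc0, kc1, diagonal_zero_blue, Finset.sum_add_distrib,
    Finset.sum_ite_eq', Finset.mem_univ, if_true, Fintype.sum_bool, Finset.sum_const_zero,
    line_false, line_true, base_false, base_true, pair_false, pair_true]
  ring

@[simp] theorem stepLeft_base_zero :
    stepLeft σ x q zero V h (base b) (memory b M) = upper σ x V q h (base b) := by
  have H : Triangle σ zero (base b) (base b) := by cases b <;> simp [base, triangle_iff]
  simp [stepLeft_of_triangle σ x H]
@[simp] theorem stepLeft_base_line :
    stepLeft σ x q (line b' i) V h (base b) (memory b M) =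
      if b' = b ∧ i ≤ M then upper σ x V q h (blue i) else 0 := by
  by_cases hb : b' = b
  · subst hb
    have H : Triangle σ (line b' i) (blue i) (base b') := by cases b' <;> simp [base, line, triangle_iff]
    rw [stepLeft_of_triangle σ x H]
    by_cases hM : M < i
    · simp [hM]
    · simp [hM, not_lt.1 hM]
  · rw [stepLeft_of_not_triangle, if_neg (by tauto)]
    intro mid; cases b <;> cases b' <;> simp_all <;> rintro ⟨⟩
@[simp] theorem stepLeft_bluePlus_zero (M : Label n) :
    stepLeft σ x q zero V h (bluePlus i) M = 0 :=
  stepLeft_of_not_triangle σ x (by rintro _ ⟨⟩) _ _ _ _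
@[simp] theorem stepLeft_bluePlus_line (M : Label n) :
    stepLeft σ x q (line b k) V h (bluePlus i) M =
      if b = false ∧ k = i then upper σ x V q h plus else 0 := by
  by_cases hb : b = false ∧ k = i
  · obtain ⟨rfl, rfl⟩ := hb
    have H : Triangle σ (line false k) plus (bluePlus k) := by simp [line, triangle_iff]
    simp [stepLeft_of_triangle σ x H]
  · rw [stepLeft_of_not_triangle, if_neg hb]
    intro mid; cases b <;> rintro ⟨⟩; simp at hb
@[simp] theorem stepLeft_pair_zero (M : Label n) :
    stepLeft σ x q zero V h (pair b f g) M = 0 :=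
  stepLeft_of_not_triangle σ x (by cases b <;> rintro _ ⟨⟩) _ _ _ _
@[simp] theorem stepLeft_pair_line (M : Label n) :
    stepLeft σ x q (line b' k) V h (pair b f g) M =
      if b' = b ∧ k = g ∧ σ f < σ g then upper σ x V q h (blue f) else 0 := by
  by_cases hb : b' = b ∧ k = g ∧ σ f < σ g
  · obtain ⟨rfl, rfl, hb⟩ := hb
    have H : Triangle σ (line b' k) (blue f) (pair b' f k) := by cases b' <;> simp [line, pair, triangle_iff, hb]
    simp [stepLeft_of_triangle σ x H, hb]
  · rw [stepLeft_of_not_triangle, if_neg hb]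
    intro mid; cases b <;> cases b' <;> rintro ⟨⟩ <;> simp_all

@[simp] theorem stepRight_base :
    stepRight σ x q t V h (base b) (memory b M) =
      (diagonal σ q (base b) fun e' => column σ x zero h t fun h' => V h' e' q) +
      ∑ i : Fin n, if i ≤ M then
        diagonal σ q (blue i) fun e' => column σ x (line b i) h t fun h' => V h' e' q else 0 := by
  have hB := fun i => banned_memory_line b b M i
  rw [stepRight_eq, sum_eq]
  cases b <;>
    simp [triangle_iff, line, base] at hB ⊢ <;>
    simp [hB, sum_eq, triangle_iff, ite_and]
@[simp] theorem stepRight_bluePlus (M : Label n) :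
    stepRight σ x q t V h (bluePlus i) M =
      diagonal σ q plus fun e' => column σ x (line false i) h t fun h' => V h' e' q := by
  simp [stepRight_eq, sum_eq, line, triangle_iff]
@[simp] theorem stepRight_pair (M : Label n) :
    stepRight σ x q t V h (pair b f g) M = if σ f < σ g then
      diagonal σ q (blue f) fun e' => column σ x (line b g) h t fun h' => V h' e' q else 0 := by
  rw [stepRight_eq]
  by_cases hfg : σ f < σ g
  · cases b <;> simp [sum_eq, triangle_iff, ite_and, hfg, line, pair, banned_iff]
  · have : ∀ w mid, ¬ Triangle σ w mid (pair b f g) := by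
      cases b <;> rintro _ _ ⟨⟩ <;> contradiction
    simp [this, hfg]
end steps

end Label

namespace Label

variable {n : ℕ} {S : Type*} [CommRing S] (σ : Equiv.Perm (Fin n)) (x : S)

/-! ### The invariant of the induction -/

/-- The linear relations between the value functions `L` and `R` of the two tilings which are
preserved by the transfer operators. -/
structure Linked (L R : Label n → Label n → Label n → S) : Prop where
  -- The vanishing statements on `R` reflect missing tiles: the right-sheared tile beside the strip
  -- would have a blue left side above a bottom label that does not allow it.
  right_zero_bluePlus (i : Fin n) : R zero (bluePlus i) (blue i) = 0
  right_zero_pair (b : Bool) (f g : Fin n) : R zero (pair b f g) (line b g) = 0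
  right_plus_crossPlus (f g : Fin n) : R plus (pair true f g) (line true g) = 0
  right_blue_bluePlus (i j : Fin n) : R (blue i) (bluePlus j) (blue j) =
    if j = i then L plus (base false) (memory false i)
    else if σ i < σ j then L plus (pair false i j) (line false j) else 0
  right_blue_pair (b : Bool) (k f g : Fin n) (h : σ g < σ k) :
    R (blue k) (pair b f g) (line b g) = 0
  right_of_ne (h : Label n) (h0 : h ≠ zero) (hp : h ≠ plus) (hb : ∀ i, h ≠ blue i) (b : Bool)
    (M : WithTop (Fin n)) : R h (base b) (memory b M) = 0
  -- On a doubled edge nothing is banned and the lower triangle exposes the second blue line, so the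
  -- value depends on two horizontal labels. This field and the next record how it behaves when they
  -- are exchanged.
  left_blue_pair (b : Bool) (k f g : Fin n) (h : k < f) (hσ : σ f < σ k) :
    L (blue k) (pair b f g) (line b g) = 0
  left_swap (b : Bool) (f g j : Fin n) (h : f < g) (hσ : σ f < σ g) (hσ' : σ g < σ j) :
    L (blue f) (pair b g j) (line b j) = L (blue g) (pair b f j) (line b j)
  -- Raising the memory from `f` to `M` admits the lines `g` with `f < g ≤ M` on the SE side.
  -- Exchanging the horizontal labels `f` and `g` turns each of them into a doubled edge.
  left_memory (b : Bool) (f : Fin n) (M : WithTop (Fin n)) (h : f ≤ M) :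
    L (blue f) (base b) (memory b M) = L (blue f) (base b) (memory b f) +
      ∑ g, if f < g ∧ g ≤ M ∧ σ f < σ g then L (blue g) (pair b f g) (line b g) else 0
  -- With `M = ⊤`, this field, the next three and `blue_base` are the claim, one relation for each
  -- choice of left and bottom labels of the left-sheared tile. The three kinds of terms in
  -- `plus_zero` are its fillings with left `0` and bottom `+`.
  zero_zero (M : WithTop (Fin n)) :
    R zero (base false) (memory false M) = L zero (base false) (memory false ⊤)
  plus_plus (M : WithTop (Fin n)) :
    R plus (base true) (memory true M) = L plus (base true) (memory true ⊤)
  zero_plus (M : WithTop (Fin n)) :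
    R zero (base true) (memory true M) = L plus (base false) (memory false ⊤)
  plus_zero (M : WithTop (Fin n)) : R plus (base false) (memory false M) =
    L zero (base true) (memory true ⊤) - x * L plus (base false) (memory false M) +
      ∑ i : Fin n, if i ≤ M then L (blue i) (bluePlus i) (blue i) else 0
  plus_bluePlus (i : Fin n) : R plus (bluePlus i) (blue i) = L plus (bluePlus i) (blue i)
  plus_cross (f g : Fin n) (h : σ f < σ g) : R plus (pair false f g) (line false g) =
    L (blue f) (bluePlus g) (blue g) - x * L plus (pair false f g) (line false g)
  blue_base (b : Bool) (f : Fin n) (M : WithTop (Fin n)) (h : f ≤ M) :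
    R (blue f) (base b) (memory b M) = L (blue f) (base b) (memory b M)
  -- When the memory `k` is below `f`, the second tiling loses the diamonds through which `f` would
  -- pass; the state with the doubled edge supplies the missing contribution.
  blue_base_of_lt (b : Bool) (f k : Fin n) (h : k < f) (hσ : σ f < σ k) :
    R (blue f) (base b) (memory b k) + R (blue k) (pair b f k) (line b k) =
      L (blue f) (base b) (memory b k)
  blue_pair (b : Bool) (k f g : Fin n) (h : σ k ≤ σ f) (h' : σ f < σ g) :
    R (blue k) (pair b f g) (line b g) +
      (if f < k then R (blue f) (pair b k g) (line b g) else 0) =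
      L (blue k) (pair b f g) (line b g)

variable {σ x} {L R : Label n → Label n → Label n → S}

theorem sum_lt_eq (σ : Equiv.Perm (Fin n)) (F : Fin n → S) (i j : Fin n) :
    (∑ g, if σ i < σ g then if j = g then F g else 0 else 0) = if σ i < σ j then F j else 0 := by
  rw [Finset.sum_eq_single j]
  · simp
  · intro g _ hg; simp [hg.symm]
  · simp

namespace Linked

/-- Expand the right-hand side by `left_memory`. The terms with `f < g` agree, and those with `g <
f` vanish by `left_blue_pair`; if `f` exceeds `M`, only vanishing terms are left. -/
theorem bounded_sum (H : Linked σ x L R) (b : Bool) (f : Fin n) (M : WithTop (Fin n)) :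
    (if f ≤ M then L (blue f) (base b) (line b f) else 0) +
      (∑ g : Fin n, if σ f < σ g then
        if g ≤ M then L (blue g) (pair b f g) (line b g) else 0 else 0) =
      if f ≤ M then L (blue f) (base b) (memory b M) else 0 := by
  split_ifs with h
  · rw [H.left_memory b f M h, memory_coe]
    congr 1
    refine Finset.sum_congr rfl fun g _ => ?_
    by_cases h1 : σ f < σ g
    · have : g ≠ f := by rintro rfl; exact lt_irrefl _ h1
      rcases lt_or_gt_of_ne this with h2 | h2
      · simp [h1, h2.not_gt, H.left_blue_pair b g f g h2 h1]
      · simp [h1, h2]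
    · simp [h1]
  · rw [zero_add]
    refine Finset.sum_eq_zero fun g _ => ?_
    split_ifs with h1 h2
    · refine H.left_blue_pair b g f g ?_ h1
      by_contra h3
      exact h ((WithTop.coe_le_coe.2 (not_lt.1 h3)).trans h2)
    · rfl
    · rfl

/-! ### Values of a tile with the triangle to its right -/

theorem upper_zero_zero_blue (H : Linked σ x L R) (i : Fin n) :
    upper σ x L zero zero (blue i) = L (blue i) zero zero := by
  simpa [base, memory_top, upper_blue] using H.bounded_sum false i ⊤

theorem upper_zero_plus_blue (H : Linked σ x L R) (i : Fin n) :
    upper σ x L zero plus (blue i) = L (blue i) plus zero := by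
  simpa [base, memory_top, upper_blue] using H.bounded_sum true i ⊤

@[simp] theorem upper_zero_blue_blue (f i : Fin n) :
    upper σ x L zero (blue f) (blue i) = 0 := by
  simp [upper_blue]

@[simp] theorem upper_line_zero (b : Bool) (j : Fin n) (mid : Label n) :
    upper σ x L (line b j) zero mid = 0 := by
  simp [upper, diagonal]

theorem upper_line_plus_blue (H : Linked σ x L R) (b : Bool) (i j : Fin n) :
    upper σ x L (line b j) plus (blue i) = if b then 0 else R (blue i) (bluePlus j) (blue j) := by
  rw [H.right_blue_bluePlus]
  cases b
  · by_cases h : j = i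
    · subst h; simp [upper_blue, sum_lt_eq, memory_coe]
    · simp [h, upper_blue, sum_lt_eq]
  · simp [upper_blue]

theorem upper_line_blue_blue (H : Linked σ x L R) (b : Bool) (j f i : Fin n) :
    upper σ x L (line b j) (blue f) (blue i) =
      if j = f then (if i ≤ f then L (blue i) (base b) (line b f) else 0)
      else if σ f < σ j then
        (if j = i then L (blue f) (base b) (line b j)
          else if σ i < σ j then L (blue f) (pair b i j) (line b j) else 0)
      else 0 := by
  by_cases h : j = f
  · subst h
    -- For `j = f` the tile turns both lines, so its right colour runs over all `g ≤ j`; this is the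
    -- bounded sum with memory `j`.
    have := H.bounded_sum b i j
    cases b <;> simp_all [upper_blue, memory_coe]
  · have hs : upper σ x L (line b j) (blue f) (blue i) =
        (if j = i ∧ σ f < σ j then L (blue f) (base b) (line b i) else 0) +
          ∑ g, if σ i < σ g then if j = g then
            if σ f < σ j then L (blue f) (pair b i g) (line b g) else 0 else 0 else 0 := by
      cases b <;> simp [h, upper_blue, ite_and]
    rw [if_neg h, hs, sum_lt_eq σ (fun g => if σ f < σ j then L (blue f) (pair b i g) (line b g) else 0)]
    by_cases h1 : σ f < σ j <;> by_cases h2 : j = i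
    · subst h2; simp [h1]
    all_goals simp [h1, h2]

@[simp] theorem upper_zero_zero_plus : upper σ x L zero zero plus =
    L zero plus zero + ∑ i, L (blue i) (bluePlus i) (blue i) := by
  simp [upper_plus]

@[simp] theorem upper_zero_plus_plus : upper σ x L zero plus plus = L plus plus zero := by
  simp [upper_plus]

@[simp] theorem upper_zero_blue_plus (f : Fin n) :
    upper σ x L zero (blue f) plus = x * L (blue f) plus zero := by
  simp [upper_plus]

@[simp] theorem upper_line_plus_plus (b : Bool) (j : Fin n) :
    upper σ x L (line b j) plus plus = if b then 0 else L plus (bluePlus j) (blue j) := by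
  cases b <;> simp [upper_plus]

@[simp] theorem upper_line_blue_plus (b : Bool) (j f : Fin n) :
    upper σ x L (line b j) (blue f) plus =
      if j = f then L (base b) plus zero +
        (if b then 0 else ∑ i, if i ≤ f then L (blue i) (bluePlus i) (blue i) else 0)
      else if b = false ∧ σ f < σ j then L (blue f) (bluePlus j) (blue j) else 0 := by
  by_cases h : j = f
  · subst h
    cases b <;> simp [upper_plus]
  · cases b <;> simp [upper_plus, h, ite_and]

theorem right_zero_zero_zero (H : Linked σ x L R) : R zero zero zero = L zero zero zero :=
  H.zero_zero ⊤
theorem right_zero_zero_blue (H : Linked σ x L R) (j : Fin n) :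
    R zero zero (blue j) = L zero zero zero :=
  H.zero_zero j
theorem right_plus_plus_zero (H : Linked σ x L R) : R plus plus zero = L plus plus zero :=
  H.plus_plus ⊤
theorem right_plus_plus_bluePlus (H : Linked σ x L R) (j : Fin n) :
    R plus plus (bluePlus j) = L plus plus zero :=
  H.plus_plus j
theorem right_zero_plus_zero (H : Linked σ x L R) : R zero plus zero = L plus zero zero :=
  H.zero_plus ⊤
theorem right_zero_plus_bluePlus (H : Linked σ x L R) (j : Fin n) :
    R zero plus (bluePlus j) = L plus zero zero :=
  H.zero_plus j
theorem right_blue_zero_zero (H : Linked σ x L R) (i : Fin n) :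
    R (blue i) zero zero = L (blue i) zero zero :=
  H.blue_base false i ⊤ le_top
theorem right_blue_plus_zero (H : Linked σ x L R) (i : Fin n) :
    R (blue i) plus zero = L (blue i) plus zero :=
  H.blue_base true i ⊤ le_top
theorem right_plus_zero_zero (H : Linked σ x L R) : R plus zero zero =
    L zero plus zero - x * L plus zero zero + ∑ i, L (blue i) (bluePlus i) (blue i) := by
  simpa [memory_top, memory_coe, base, line] using H.plus_zero ⊤
theorem right_plus_zero_blue (H : Linked σ x L R) (j : Fin n) : R plus zero (blue j) =
    L zero plus zero - x * L plus zero (blue j) +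
      ∑ i, if i ≤ j then L (blue i) (bluePlus i) (blue i) else 0 := by
  simpa [memory_top, memory_coe, base, line] using H.plus_zero j
theorem right_zero_cross (H : Linked σ x L R) (f g : Fin n) : R zero (cross f g) (blue g) = 0 :=
  H.right_zero_pair false f g
theorem right_zero_crossPlus (H : Linked σ x L R) (f g : Fin n) :
    R zero (crossPlus f g) (bluePlus g) = 0 :=
  H.right_zero_pair true f g
theorem right_plus_crossPlus_bluePlus (H : Linked σ x L R) (f g : Fin n) :
    R plus (crossPlus f g) (bluePlus g) = 0 :=
  H.right_plus_crossPlus f g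
theorem right_plus_cross (H : Linked σ x L R) {f g : Fin n} (h : σ f < σ g) :
    R plus (cross f g) (blue g) =
      L (blue f) (bluePlus g) (blue g) - x * L plus (cross f g) (blue g) :=
  H.plus_cross f g h
theorem right_blue_bluePlus_self (H : Linked σ x L R) (j : Fin n) :
    R (blue j) (bluePlus j) (blue j) = L plus zero (blue j) := by
  rw [H.right_blue_bluePlus, if_pos rfl]; rfl
theorem right_blue_bluePlus_of_lt (H : Linked σ x L R) {i j : Fin n} (h : σ i < σ j) :
    R (blue i) (bluePlus j) (blue j) = L plus (cross i j) (blue j) := by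
  rw [H.right_blue_bluePlus, if_neg (by rintro rfl; exact lt_irrefl _ h), if_pos h]; rfl

end Linked

end Label

namespace Label

variable {n : ℕ} {S : Type*} [CommRing S] {σ : Equiv.Perm (Fin n)} {x : S}
  {L R : Label n → Label n → Label n → S}

/-! ### One row preserves the relations -/

/-- A label carrying at most one blue line, and a red line only together with a blue one. -/
def Slanted (q : Label n) : Prop := q = zero ∨ ∃ b i, q = line b i

theorem not_slanted {q : Label n} (h : ¬ Slanted q) : q = plus ∨ ∃ b f g, q = pair b f g := by
  rcases q with _ | _ | i | i | ⟨f, g⟩ | ⟨f, g⟩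
  · exact (h (.inl rfl)).elim
  · exact .inl rfl
  · exact (h (.inr ⟨false, i, rfl⟩)).elim
  · exact (h (.inr ⟨true, i, rfl⟩)).elim
  · exact .inr ⟨false, f, g, rfl⟩
  · exact .inr ⟨true, f, g, rfl⟩

namespace Linked

variable {q t : Label n}

theorem step_right_zero_bluePlus (hq : Slanted q) (ht : Slanted t) (i : Fin n) :
    stepRight σ x q t R zero (bluePlus i) (blue i) = 0 := by
  obtain rfl | ⟨b, j, rfl⟩ := hq <;> obtain rfl | ⟨b', k, rfl⟩ := ht <;> simp

theorem step_right_zero_pair (hq : Slanted q) (ht : Slanted t) (b : Bool) (f g : Fin n) :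
    stepRight σ x q t R zero (pair b f g) (line b g) = 0 := by
  obtain rfl | ⟨b', j, rfl⟩ := hq <;> obtain rfl | ⟨b', k, rfl⟩ := ht <;> simp

theorem step_right_plus_crossPlus (hq : Slanted q) (ht : Slanted t) (f g : Fin n) :
    stepRight σ x q t R plus (pair true f g) (line true g) = 0 := by
  obtain rfl | ⟨b', j, rfl⟩ := hq <;> obtain rfl | ⟨b', k, rfl⟩ := ht <;> simp

theorem step_right_blue_bluePlus (H : Linked σ x L R) (hq : Slanted q) (ht : Slanted t)
    (i j : Fin n) :
    stepRight σ x q t R (blue i) (bluePlus j) (blue j) =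
    if j = i then stepLeft σ x q t L plus (base false) (memory false i)
    else if σ i < σ j then stepLeft σ x q t L plus (pair false i j) (line false j) else 0 := by
  rcases eq_or_ne j i with rfl | hj
  · obtain rfl | ⟨b, l, rfl⟩ := hq <;> obtain rfl | ⟨b', k, rfl⟩ := ht <;>
      simp [H.upper_zero_plus_blue, H.upper_line_plus_blue, H.right_blue_plus_zero, ite_and]
    · simp [base_false, H.right_zero_plus_zero]
    · simp only [base_false, upper_zero, column_line_plus_zero]
      cases b <;> simp [line, H.right_zero_bluePlus]
    · cases b <;> cases b' <;> simp [line]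
  · by_cases hσ : σ i < σ j
    · obtain rfl | ⟨b, l, rfl⟩ := hq <;> obtain rfl | ⟨b', k, rfl⟩ := ht <;>
        simp [H.upper_zero_plus_blue, H.upper_line_plus_blue, hj, H.right_blue_plus_zero,
          ite_and, eq_comm (a := j), hσ]
      cases b <;> cases b' <;> simp [line]
    · obtain rfl | ⟨b, l, rfl⟩ := hq <;> obtain rfl | ⟨b', k, rfl⟩ := ht <;> simp [hj, hσ]

theorem step_right_blue_pair (hq : Slanted q) (ht : Slanted t)
    (b : Bool) (k f g : Fin n) (h : σ g < σ k) :
    stepRight σ x q t R (blue k) (pair b f g) (line b g) = 0 := by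
  have : g ≠ k := by rintro rfl; exact lt_irrefl _ h
  obtain rfl | ⟨b', j, rfl⟩ := hq <;> obtain rfl | ⟨b', l, rfl⟩ := ht <;>
    simp [this, h.not_gt]

theorem step_right_of_ne (h : Label n) (h0 : h ≠ zero) (hp : h ≠ plus)
    (hb : ∀ i, h ≠ blue i) (b : Bool) (M : WithTop (Fin n)) :
    stepRight σ x q t R h (base b) (memory b M) = 0 := by
  simp [column_of_ne σ x _ h0 hp hb, diagonal]

/-- If `q` carries one of the two colours, both sides are read off from the tile table. Otherwise
the exchange is inherited from `left_swap` and `left_blue_pair` one row higher. -/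
theorem upper_blue_swap (H : Linked σ x L R) (hq : Slanted q) {f i : Fin n} (h : f < i) :
    upper σ x L q (blue f) (blue i) =
      if σ f < σ i then upper σ x L q (blue i) (blue f) else 0 := by
  obtain rfl | ⟨b, j, rfl⟩ := hq
  · simp [upper_zero_blue_blue]
  · rw [H.upper_line_blue_blue, H.upper_line_blue_blue]
    by_cases h1 : j = f
    · subst h1
      simp +contextual [h.not_ge, h.ne, not_lt_of_gt]
    by_cases h2 : j = i
    · subst h2
      simp [h1, h.le]
    have hne : σ f ≠ σ i := fun e => h.ne (σ.injective e)
    rcases lt_or_gt_of_ne hne with h3 | h3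
    · simp only [h1, h2, if_false, h3, if_true]
      by_cases h4 : σ i < σ j
      · simp [h4, h3.trans h4, H.left_swap b f i j h h3 h4]
      · simp [h4]
    · simp only [h1, h2, if_false, h3.not_gt]
      split_ifs <;> first | rfl | exact H.left_blue_pair b f i j h h3

theorem step_left_blue_pair (H : Linked σ x L R) (hq : Slanted q) (ht : Slanted t)
    (b : Bool) (k f g : Fin n) (h : k < f) (hσ : σ f < σ k) :
    stepLeft σ x q t L (blue k) (pair b f g) (line b g) = 0 := by
  obtain rfl | ⟨b', j, rfl⟩ := ht <;> simp [H.upper_blue_swap hq h, hσ.not_gt]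

theorem step_left_swap (H : Linked σ x L R) (hq : Slanted q) (ht : Slanted t)
    (b : Bool) (f g j : Fin n) (h : f < g) (hσ : σ f < σ g) (hσ' : σ g < σ j) :
    stepLeft σ x q t L (blue f) (pair b g j) (line b j) =
      stepLeft σ x q t L (blue g) (pair b f j) (line b j) := by
  obtain rfl | ⟨b', k, rfl⟩ := ht <;> simp [H.upper_blue_swap hq h, hσ, hσ', hσ.trans hσ']

theorem step_left_memory (H : Linked σ x L R) (hq : Slanted q) (ht : Slanted t)
    (b : Bool) (f : Fin n) (M : WithTop (Fin n)) (h : f ≤ M) :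
    stepLeft σ x q t L (blue f) (base b) (memory b M) =
      stepLeft σ x q t L (blue f) (base b) (memory b f) +
      ∑ g, if f < g ∧ g ≤ M ∧ σ f < σ g then
        stepLeft σ x q t L (blue g) (pair b f g) (line b g) else 0 := by
  obtain rfl | ⟨b', k, rfl⟩ := ht
  · simp
  · by_cases hb : b' = b
    · subst hb
      simp
      rw [Finset.sum_eq_single k]
      · rcases le_or_gt k f with h1 | h1
        · simp [h1, h1.not_gt, (WithTop.coe_le_coe.2 h1).trans h]
        · simp [h1, h1.not_ge, H.upper_blue_swap hq h1, ite_and]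
          split_ifs <;> rfl
      · intro g _ hg; simp [hg.symm]
      · simp
    · simp [hb]

theorem step_zero_zero (H : Linked σ x L R) (hq : Slanted q) (ht : Slanted t)
    (M : WithTop (Fin n)) :
    stepRight σ x q t R zero (base false) (memory false M) =
      stepLeft σ x q t L zero (base false) (memory false ⊤) := by
  obtain rfl | ⟨b, l, rfl⟩ := hq <;> obtain rfl | ⟨b', j, rfl⟩ := ht <;>
    simp only [stepRight_base, stepLeft_base_zero, stepLeft_base_line] <;>
    simp [H.upper_zero_zero_blue, upper_line_zero, base_false, H.right_zero_zero_zero,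
      H.right_blue_zero_zero]
  cases b' <;> rfl

theorem step_plus_plus (H : Linked σ x L R) (hq : Slanted q) (ht : Slanted t)
    (M : WithTop (Fin n)) :
    stepRight σ x q t R plus (base true) (memory true M) =
      stepLeft σ x q t L plus (base true) (memory true ⊤) := by
  obtain rfl | ⟨b, l, rfl⟩ := hq <;> obtain rfl | ⟨b', j, rfl⟩ := ht <;>
    simp only [stepRight_base, stepLeft_base_zero, stepLeft_base_line] <;>
    simp [H.upper_zero_plus_blue, H.upper_line_plus_blue, base_true, H.right_plus_plus_zero,
      H.right_blue_plus_zero]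
  · cases b <;> simp [line, H.plus_bluePlus]
  · cases b <;> cases b' <;> simp [line]

theorem step_zero_plus (H : Linked σ x L R) (hq : Slanted q) (ht : Slanted t)
    (M : WithTop (Fin n)) :
    stepRight σ x q t R zero (base true) (memory true M) =
      stepLeft σ x q t L plus (base false) (memory false ⊤) := by
  obtain rfl | ⟨b, l, rfl⟩ := hq <;> obtain rfl | ⟨b', j, rfl⟩ := ht <;>
    simp only [stepRight_base, stepLeft_base_zero, stepLeft_base_line] <;>
    simp [H.upper_zero_plus_blue, H.upper_line_plus_blue, base_true, base_false,
      H.right_zero_plus_zero, H.right_blue_plus_zero]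
  · cases b' <;> simp
  · cases b <;> simp [line, H.right_zero_bluePlus]
  · cases b <;> cases b' <;> simp [line]

/-- This compares the two tilings when a blue line `f` meets the red line next to the side label
`line b l`. The correction `-x` in `plus_zero` and `plus_cross` is exactly `x` times the value `R
(blue f) (bluePlus l) (blue l)`. -/
theorem right_plus_turn (H : Linked σ x L R) (b : Bool) (l f : Fin n) :
    (if l = f then R plus (base b) (line b l)
      else if σ f < σ l then R plus (pair b f l) (line b l) else 0) =
      (if l = f then L (base b) plus zero +
        (if b then 0 else ∑ i, if i ≤ f then L (blue i) (bluePlus i) (blue i) else 0)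
      else if b = false ∧ σ f < σ l then L (blue f) (bluePlus l) (blue l) else 0) -
      (if b then 0 else x * R (blue f) (bluePlus l) (blue l)) := by
  by_cases h : l = f
  · subst h
    cases b
    · simp [line, base, H.right_plus_zero_blue, H.right_blue_bluePlus_self]
      ring
    · simp [line, base, H.right_plus_plus_bluePlus]
  · by_cases hσ : σ f < σ l
    · cases b
      · simp [line, pair, h, hσ, H.right_plus_cross, H.right_blue_bluePlus_of_lt]
      · simp [line, pair, h, hσ, H.right_plus_crossPlus_bluePlus]
    · cases b
      · simp [h, hσ, H.right_blue_bluePlus]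
      · simp [h, hσ]

theorem step_plus_zero (H : Linked σ x L R) (hq : Slanted q) (ht : Slanted t)
    (M : WithTop (Fin n)) :
    stepRight σ x q t R plus (base false) (memory false M) =
    stepLeft σ x q t L zero (base true) (memory true ⊤) -
      x * stepLeft σ x q t L plus (base false) (memory false M) +
      ∑ i : Fin n, if i ≤ M then stepLeft σ x q t L (blue i) (bluePlus i) (blue i) else 0 := by
  obtain rfl | ⟨b, l, rfl⟩ := hq <;> obtain rfl | ⟨b', j, rfl⟩ := ht <;>
    simp only [stepRight_base, stepLeft_base_zero, stepLeft_base_line] <;>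
    simp [H.upper_zero_plus_blue, H.upper_line_plus_blue, H.upper_zero_zero_blue, base_false,
      base_true]
  · rw [H.right_plus_zero_zero]; ring
  · cases b'
    · simp
      rw [Finset.sum_eq_single j (by intro i _ hi; simp [hi.symm]) (by simp)]
      simp
    · simp [H.right_blue_zero_zero]
  · cases b'
    -- Only the colour `j` on the SE side contributes to either sum, and the memory then allows it
    -- on both sides or on neither.
    · rw [Finset.sum_eq_single j (by intro i _ hi; simp [hi]) (by simp),
        Finset.sum_eq_single j (by intro i _ hi; simp [hi.symm]) (by simp)]
      by_cases hj : (j : WithTop (Fin n)) ≤ M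
      · have := H.right_plus_turn b l j
        simp only [hj, if_true, and_self]
        rw [this]; ring
      · simp [hj]
    · simp

theorem step_plus_bluePlus (H : Linked σ x L R) (hq : Slanted q) (ht : Slanted t) (i : Fin n) :
    stepRight σ x q t R plus (bluePlus i) (blue i) =
      stepLeft σ x q t L plus (bluePlus i) (blue i) := by
  obtain rfl | ⟨b, l, rfl⟩ := hq <;> obtain rfl | ⟨b', j, rfl⟩ := ht <;>
    simp [H.right_plus_plus_zero, eq_comm (a := i)]
  cases b <;> simp [line, H.plus_bluePlus]

theorem step_plus_cross (H : Linked σ x L R) (hq : Slanted q) (ht : Slanted t) (f g : Fin n)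
    (h : σ f < σ g) :
    stepRight σ x q t R plus (pair false f g) (line false g) =
      stepLeft σ x q t L (blue f) (bluePlus g) (blue g) -
        x * stepLeft σ x q t L plus (pair false f g) (line false g) := by
  obtain rfl | ⟨b, l, rfl⟩ := hq <;> obtain rfl | ⟨b', j, rfl⟩ := ht <;>
    simp [h, H.upper_zero_plus_blue, H.upper_line_plus_blue]
  by_cases hj : b' = false ∧ j = g
  · obtain ⟨rfl, rfl⟩ := hj
    simpa using H.right_plus_turn b l f
  · simp [hj, eq_comm (a := g)]

/-- The two terms are the tiles of the second tiling with bottom `f` and empty right side: the line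
goes straight up with weight `x`, or turns left into the strip. -/
theorem upper_blue_base (H : Linked σ x L R) (hq : Slanted q) (b : Bool) (f : Fin n) :
    upper σ x L q (blue f) (base b) =
      (diagonal σ q (base b) fun e => x * R (blue f) e q) +
        diagonal σ q (blue f) fun e => R (base b) e q := by
  obtain rfl | ⟨b', j, rfl⟩ := hq
  · cases b
    · simp [base_false, H.right_blue_zero_zero]
    · simp [base_true, H.right_blue_plus_zero]
  · cases b
    · simp only [base_false, upper_zero, column_line_blue_zero, diagonal_line_zero,
        diagonal_line_blue]
      cases b' <;> by_cases h : j = f <;>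
        simp [h, H.right_zero_cross, H.right_zero_crossPlus, H.right_zero_zero_blue,
          H.right_zero_plus_bluePlus, line, base, pair]
    · have := H.right_plus_turn b' j f
      simp only [base_true, diagonal_line_plus, diagonal_line_blue, upper_line_blue_plus, this]
      cases b' <;> simp [line]

/-- The two terms are the tiles of the second tiling with bottom `f` and right colour `k`: the lines
both turn, which needs `k ≤ f`, or cross, which needs `σ f < σ k`. -/
theorem upper_blue_blue (H : Linked σ x L R) (hq : Slanted q) (f k : Fin n) :
    upper σ x L q (blue f) (blue k) =
      (if k ≤ f then diagonal σ q (blue f) fun e => R (blue k) e q else 0) +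
        (if σ f < σ k then diagonal σ q (blue k) fun e => R (blue f) e q else 0) := by
  obtain rfl | ⟨b, j, rfl⟩ := hq
  · simp
  rw [H.upper_line_blue_blue, diagonal_line_blue, diagonal_line_blue]
  by_cases hj : j = f
  · subst hj
    have h2 : (if σ j < σ k then if j = k then R (blue j) (base b) (line b j)
        else if σ k < σ j then R (blue j) (pair b k j) (line b j) else 0 else 0) = 0 := by
      by_cases h1 : σ j < σ k
      · have : j ≠ k := by rintro rfl; exact lt_irrefl _ h1
        simp [this, h1.not_gt]
      · simp [h1]
    rw [h2, add_zero]
    simp only [if_true]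
    split_ifs with h
    · exact (H.blue_base b k j (WithTop.coe_le_coe.2 h)).symm
    · rfl
  by_cases hfj : σ f < σ j
  · by_cases hjk : j = k
    · subst hjk
      simp only [hj, hfj, if_true, if_false]
      split_ifs with h
      · rw [add_comm]
        exact (H.blue_base_of_lt b f j (lt_of_le_of_ne h hj) hfj).symm
      · rw [zero_add]
        exact (H.blue_base b f j (WithTop.coe_le_coe.2 (not_le.1 h).le)).symm
    · simp only [hj, hjk, hfj, if_true, if_false]
      by_cases hkj : σ k < σ j
      · simp only [hkj, if_true]
        -- If `σ f ≤ σ k`, then `blue_pair` applies directly. If `σ k < σ f`, the left value either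
        -- is brought to that form by `left_swap` or vanishes.
        rcases lt_trichotomy (σ f) (σ k) with h | h | h
        · have hk := H.blue_pair b f k j h.le hkj
          have hne : k ≠ f := by rintro rfl; exact lt_irrefl _ h
          rw [← hk, add_comm, if_pos h]
          simp only [hne.le_iff_lt]
        · obtain rfl := σ.injective h
          have hk := H.blue_pair b f f j le_rfl hkj
          simpa using hk.symm
        · rw [if_neg h.not_gt, add_zero]
          have hne : k ≠ f := by rintro rfl; exact lt_irrefl _ h
          rcases lt_or_gt_of_ne hne with h1 | h1
          · rw [if_pos h1.le, ← H.left_swap b k f j h1 h hfj, ← H.blue_pair b k f j h.le hfj,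
              if_neg h1.not_gt, add_zero]
          · rw [if_neg h1.not_ge, H.left_blue_pair b f k j h1 h]
      · have hjk' : σ j < σ k := lt_of_le_of_ne (not_lt.1 hkj) fun h => hjk (σ.injective h)
        simp [hkj, H.right_blue_pair b k f j hjk']
  · have h2 : (if σ f < σ k then if j = k then R (blue f) (base b) (line b j)
        else if σ k < σ j then R (blue f) (pair b k j) (line b j) else 0 else 0) = 0 := by
      split_ifs with h3 h4 h5
      · subst h4; exact absurd h3 hfj
      · exact absurd (h3.trans h5) hfj
      all_goals rfl
    rw [h2]
    simp [hj, hfj]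

theorem stepRight_blue_base_zero (b : Bool) (f : Fin n) (M : WithTop (Fin n)) :
    stepRight σ x q zero R (blue f) (base b) (memory b M) =
      (diagonal σ q (base b) fun e => x * R (blue f) e q) +
        if f ≤ M then diagonal σ q (blue f) fun e => R (base b) e q else 0 := by
  simp only [stepRight_base, column_zero_blue_zero, column_line_blue_zero, diagonal_ite]
  congr 1
  rw [Finset.sum_eq_single f (by intro i _ hi; simp [hi]) (by simp)]
  simp

theorem stepRight_blue_base_line (b : Bool) (f k : Fin n) (M : WithTop (Fin n)) :
    stepRight σ x q (line b k) R (blue f) (base b) (memory b M) =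
      (if f ≤ M ∧ k ≤ f then diagonal σ q (blue f) fun e => R (blue k) e q else 0) +
        if k ≤ M ∧ σ f < σ k then diagonal σ q (blue k) fun e => R (blue f) e q else 0 := by
  simp only [stepRight_base, column_zero_blue_line, column_line_blue_line, diagonal_zero_fun,
    diagonal_ite, diagonal_add, if_true, zero_add]
  have h1 : ∀ i : Fin n, ((if (i : WithTop (Fin n)) ≤ M then
      (if i = f ∧ k ≤ i then diagonal σ q (blue i) fun e => R (blue k) e q else 0) +
      (if i = k ∧ σ f < σ i then diagonal σ q (blue i) fun e => R (blue f) e q else 0) else 0) : S)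
      = (if i = f then
        (if f ≤ M ∧ k ≤ f then diagonal σ q (blue f) fun e => R (blue k) e q else 0) else 0) +
        (if i = k then
        (if k ≤ M ∧ σ f < σ k then diagonal σ q (blue k) fun e => R (blue f) e q else 0) else 0) := by
    intro i
    by_cases h1 : (i : WithTop (Fin n)) ≤ M
    · rw [if_pos h1]
      congr 1
      · by_cases h2 : i = f
        · subst h2; simp [h1]
        · simp [h2]
      · by_cases h2 : i = k
        · subst h2; simp [h1]
        · simp [h2]
    · rw [if_neg h1]
      by_cases h2 : i = f <;> by_cases h3 : i = k
      all_goals subst_vars; simp [*]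
  simp [h1, Finset.sum_add_distrib]

theorem stepRight_blue_base_line_of_ne {b b' : Bool} (hb : b' ≠ b) (f k : Fin n)
    (M : WithTop (Fin n)) :
    stepRight σ x q (line b' k) R (blue f) (base b) (memory b M) = 0 := by
  simp [hb.symm, diagonal_zero_fun]

theorem step_blue_base (H : Linked σ x L R) (hq : Slanted q) (ht : Slanted t)
    (b : Bool) (f : Fin n) (M : WithTop (Fin n)) (h : f ≤ M) :
    stepRight σ x q t R (blue f) (base b) (memory b M) =
      stepLeft σ x q t L (blue f) (base b) (memory b M) := by
  obtain rfl | ⟨b', k, rfl⟩ := ht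
  · rw [stepRight_blue_base_zero, stepLeft_base_zero, H.upper_blue_base hq, if_pos h]
  · by_cases hb : b' = b
    · subst hb
      rw [stepRight_blue_base_line, stepLeft_base_line, H.upper_blue_blue hq]
      by_cases hk : (k : WithTop (Fin n)) ≤ M
      · simp [h, hk]
      · have : ¬ k ≤ f := fun hk' => hk ((WithTop.coe_le_coe.2 hk').trans h)
        simp [hk, this]
    · rw [stepRight_blue_base_line_of_ne hb]
      simp [hb]

/-- The memory `k` forbids the SE label of colour `f`, hence the diagonal `f`. The doubled edge has
this diagonal and no ban, so it restores the lost term. -/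
theorem step_blue_base_of_lt (H : Linked σ x L R) (hq : Slanted q) (ht : Slanted t)
    (b : Bool) (f k : Fin n) (h : k < f) (hσ : σ f < σ k) :
    stepRight σ x q t R (blue f) (base b) (memory b k) +
      stepRight σ x q t R (blue k) (pair b f k) (line b k) =
      stepLeft σ x q t L (blue f) (base b) (memory b k) := by
  have hk : ¬ (f : WithTop (Fin n)) ≤ k := by simpa using h
  obtain rfl | ⟨b', j, rfl⟩ := ht
  · rw [stepRight_blue_base_zero, stepLeft_base_zero, H.upper_blue_base hq, if_neg hk,
      stepRight_pair, if_pos hσ]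
    simp
  · by_cases hb : b' = b
    · subst hb
      rw [stepRight_blue_base_line, stepLeft_base_line, H.upper_blue_blue hq, stepRight_pair,
        if_pos hσ]
      by_cases hj : j ≤ k
      · simp [hj, hj.trans h.le, h.not_ge, add_comm]
      · simp [hj, h.not_ge, diagonal_zero_fun]
    · rw [stepRight_blue_base_line_of_ne hb]
      simp [hb, Ne.symm hb, diagonal_zero_fun]

/-- Only the side label `line b g` survives, and the right-sheared tile must then be a crossing.
What remains is `upper_blue_blue` with the roles of `f` and `k` exchanged. -/
theorem step_blue_pair (H : Linked σ x L R) (hq : Slanted q) (ht : Slanted t)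
    (b : Bool) (k f g : Fin n) (h : σ k ≤ σ f) (h' : σ f < σ g) :
    stepRight σ x q t R (blue k) (pair b f g) (line b g) +
      (if f < k then stepRight σ x q t R (blue f) (pair b k g) (line b g) else 0) =
      stepLeft σ x q t L (blue k) (pair b f g) (line b g) := by
  have hk := h.trans_lt h'
  have hgk : g ≠ k := by rintro rfl; exact lt_irrefl _ hk
  have hgf : g ≠ f := by rintro rfl; exact lt_irrefl _ h'
  obtain rfl | ⟨b', j, rfl⟩ := ht
  · simp [hgk, hgf, diagonal_zero_fun]
  · by_cases hj : b' = b ∧ j = g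
    · obtain ⟨rfl, rfl⟩ := hj
      simp only [stepRight_pair, stepLeft_pair_line, h', hk, H.upper_blue_blue hq,
        column_line_blue_line, hgk, hgf, if_true, if_false, false_and, zero_add, true_and]
      rcases eq_or_ne k f with rfl | hne
      · simp
      · have : σ k < σ f := lt_of_le_of_ne h fun e => hne (σ.injective e)
        simp only [this, if_true, hne.symm.le_iff_lt]
        ring
    · have : ¬ (b = b' ∧ g = j) := by tauto
      by_cases hb : b' = b
      · have hg : g ≠ j := by tauto
        simp [hb, hg, hg.symm, hgk, hgf, diagonal_zero_fun]
      · simp [hb, Ne.symm hb, diagonal_zero_fun]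

theorem step_of_slanted (H : Linked σ x L R) (hq : Slanted q) (ht : Slanted t) :
    Linked σ x (stepLeft σ x q t L) (stepRight σ x q t R) where
  right_zero_bluePlus := step_right_zero_bluePlus hq ht
  right_zero_pair := step_right_zero_pair hq ht
  right_plus_crossPlus := step_right_plus_crossPlus hq ht
  right_blue_bluePlus := H.step_right_blue_bluePlus hq ht
  right_blue_pair := step_right_blue_pair hq ht
  right_of_ne := step_right_of_ne
  left_blue_pair := H.step_left_blue_pair hq ht
  left_swap := H.step_left_swap hq ht
  left_memory := H.step_left_memory hq ht
  zero_zero := H.step_zero_zero hq ht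
  plus_plus := H.step_plus_plus hq ht
  zero_plus := H.step_zero_plus hq ht
  plus_zero := H.step_plus_zero hq ht
  plus_bluePlus := H.step_plus_bluePlus hq ht
  plus_cross := H.step_plus_cross hq ht
  blue_base := H.step_blue_base hq ht
  blue_base_of_lt := H.step_blue_base_of_lt hq ht
  blue_pair := H.step_blue_pair hq ht

end Linked

/-! ### Impossible side labels, and the top of the hexagon -/

theorem stepLeft_of_not_slanted {q t : Label n} (h : ¬ (Slanted q ∧ Slanted t)) :
    stepLeft σ x q t L = fun _ _ _ => 0 := by
  funext h' e M
  by_cases hq : Slanted q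
  · refine stepLeft_of_not_triangle σ x (fun mid H => h ⟨hq, ?_⟩) _ _ _ _
    cases H
    · exact .inl rfl
    · exact .inr ⟨false, _, rfl⟩
    · exact .inr ⟨true, _, rfl⟩
    · exact .inl rfl
    · exact .inr ⟨false, _, rfl⟩
    · exact .inr ⟨false, _, rfl⟩
    · exact .inr ⟨true, _, rfl⟩
  · obtain rfl | ⟨b, f, g, rfl⟩ := not_slanted hq
    · simp [stepLeft, column_plus_left]
    · simp [stepLeft, column_pair_left]

theorem stepRight_of_not_slanted {q t : Label n} (h : ¬ (Slanted q ∧ Slanted t)) :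
    stepRight σ x q t R = fun _ _ _ => 0 := by
  funext h' e M
  by_cases hq : Slanted q
  · have ht : ¬ Slanted t := fun ht => h ⟨hq, ht⟩
    obtain rfl | ⟨b, f, g, rfl⟩ := not_slanted ht
    · simp [stepRight, column_plus_right]
    · simp [stepRight, column_pair_right]
  · obtain rfl | ⟨b, f, g, rfl⟩ := not_slanted hq
    · simp [stepRight_eq, diagonal_plus]
    · simp [stepRight_eq, diagonal_pair]

/-- All the relations are homogeneous, which disposes of rows whose side labels occur on no tile. -/
theorem linked_zero : Linked σ x (fun _ _ _ => 0) (fun _ _ _ => 0) := by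
  constructor <;> simp

theorem Linked.step (H : Linked σ x L R) (q t : Label n) :
    Linked σ x (stepLeft σ x q t L) (stepRight σ x q t R) := by
  by_cases h : Slanted q ∧ Slanted t
  · exact H.step_of_slanted h.1 h.2
  · rw [stepLeft_of_not_slanted h, stepRight_of_not_slanted h]
    exact linked_zero

/-- With no rows left, the first tiling only tests the labels, while the second still has its
left-sheared tile. The restriction on `u` matters: a doubled label `u` could violate
`left_blue_pair`. -/
theorem linked_final {u : Label n} (hu : u = zero ∨ u = plus) (v : Label n) :
    Linked σ x (fun h e _ => if h = v ∧ e = u then 1 else 0)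
      (fun h e _ => leftWeight x e h u v) := by
  have h0 : ∀ b f g (h : Label n), leftWeight x (pair b f g) h u v = 0 := by
    intro b f g h
    cases b <;> simp [leftWeight, leftTrivial_iff, leftNontrivial_iff, pair]
  have h1 : ∀ b f g, pair b f g ≠ u := by
    intro b f g
    obtain rfl | rfl := hu <;> cases b <;> simp [pair]
  have h2 : ∀ b f, leftWeight x (base b) (blue f) u v = if blue f = v ∧ base b = u then 1 else 0 := by
    intro b f
    obtain rfl | rfl := hu <;> cases b <;> cases v <;>
      simp [leftWeight, leftTrivial_iff, leftNontrivial_iff, base]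
  constructor
  case right_of_ne =>
    intro h hz hp hb b M
    have h3 : ¬ LeftTrivial (base b) h u v := by
      intro H
      generalize base b = l at H
      cases H <;> first | exact hz rfl | exact hp rfl | exact hb _ rfl
    simp [leftWeight, h3, leftNontrivial_iff, hp]
  all_goals intros
  all_goals first
    | simp [h0, h1, h2]; done
    | obtain rfl | rfl := hu <;> cases v <;>
        simp [leftWeight, leftTrivial_iff, leftNontrivial_iff, base, pair, eq_comm]

end Label

namespace Label

variable {n : ℕ} {S : Type*} [CommRing S] (σ : Equiv.Perm (Fin n)) (x : S)

/-! ### Partition functions as iterated transfer operators -/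

theorem sum_fin_succ {α : Type*} [Fintype α] {m : ℕ} (F : (Fin (m + 1) → α) → S) :
    ∑ p, F p = ∑ a, ∑ p : Fin m → α, F (Fin.cons (α := fun _ => α) a p) := by
  rw [← (Fin.consEquiv fun _ => α).sum_comp, Fintype.sum_prod_type]
  rfl

/-- A legal strip of diamonds above a diamond with NW label `M`. -/
def StripAbove {m : ℕ} (M : Label n) (e : Fin (m + 1) → Label n) (se nw : Fin m → Label n) : Prop :=
  DiamondStrip σ e se nw ∧ ∀ l : Fin m, (l : ℕ) = 0 → ¬ Banned M (e l.castSucc) (se l)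

theorem stripAbove_zero {m : ℕ} (e : Fin (m + 1) → Label n) (se nw : Fin m → Label n) :
    StripAbove σ zero e se nw ↔ DiamondStrip σ e se nw := by
  simp [StripAbove]

/-- Bans involve only consecutive diamonds, so after removing the lowest one its NW label is all
that must be remembered. -/
theorem stripAbove_succ {m : ℕ} (M e₀ : Label n) (e : Fin (m + 1) → Label n)
    (se nw : Fin (m + 1) → Label n) :
    StripAbove σ M (Fin.cons (α := fun _ => Label n) e₀ e) se nw ↔
      (¬ Banned M e₀ (se 0) ∧ Diamond σ e₀ (se 0) (nw 0) (e 0)) ∧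
        StripAbove σ (nw 0) e (fun k => se k.succ) (fun k => nw k.succ) := by
  have h0 : ∀ k : Fin m, Fin.cons (α := fun _ => Label n) e₀ e k.succ.castSucc = e k.castSucc :=
    fun k => by rw [← Fin.succ_castSucc, Fin.cons_succ]
  constructor
  · rintro ⟨⟨h1, h2⟩, h3⟩
    refine ⟨⟨h3 0 rfl, h1 0⟩, ⟨fun k => ?_, fun k l hkl => ?_⟩, fun l hl => ?_⟩
    · simpa only [h0, Fin.cons_succ] using h1 k.succ
    · simpa only [Fin.cons_succ] using h2 k.succ l.succ (by simp [hkl])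
    · have := h2 0 l.succ (by simp [hl])
      have h4 : l.castSucc = 0 := Fin.ext hl
      rw [h4]
      simpa only [Fin.cons_succ] using this
  · rintro ⟨⟨h1, h2⟩, ⟨h3, h4⟩, h5⟩
    refine ⟨⟨fun k => ?_, fun k l hkl => ?_⟩, fun l hl => ?_⟩
    · induction k using Fin.cases with
      | zero => exact h2
      | succ k => simpa only [h0, Fin.cons_succ] using h3 k
    · induction l using Fin.cases with
      | zero => simp at hkl
      | succ l =>
        induction k using Fin.cases with
        | zero =>
          have hl : (l : ℕ) = 0 := by simpa using hkl
          have h6 : l.castSucc = 0 := Fin.ext hl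
          simpa only [h6, Fin.cons_succ] using h5 l hl
        | succ k => simpa only [Fin.cons_succ] using h4 k l (by simpa using hkl)
    · have : l = 0 := Fin.ext hl
      subst this
      exact h1

open Classical in
/-- One step of a transfer operator: `c w h h'` is the weight of the right-sheared tile, `se w` and
`nw w` are the SE and NW labels of the diamond. -/
noncomputable def transfer (c : Label n → Label n → Label n → S) (se nw : Label n → Label n)
    (V : Label n → Label n → Label n → S) (h e M : Label n) : S :=
  ∑ h', ∑ e', ∑ w, if ¬ Banned M e (se w) ∧ Diamond σ e (se w) (nw w) e' then
    c w h h' * V h' e' (nw w) else 0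

/-- The value function obtained by composing `m` transfer operators. -/
noncomputable def value (fin : Label n → Label n → S) : (m : ℕ) →
    (Fin m → Label n → Label n → Label n → S) → (Fin m → Label n → Label n) →
    (Fin m → Label n → Label n) → Label n → Label n → Label n → S
  | 0, _, _, _ => fun h e _ => fin h e
  | m + 1, c, se, nw => transfer σ (c 0) (se 0) (nw 0)
      (value fin m (fun k => c k.succ) (fun k => se k.succ) (fun k => nw k.succ))

open Classical in
theorem sum_paths (fin : Label n → Label n → S) (m : ℕ)
    (c : Fin m → Label n → Label n → Label n → S) (se nw : Fin m → Label n → Label n)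
    (h₀ e₀ M : Label n) :
    ∑ h : Fin m → Label n, ∑ e : Fin m → Label n, ∑ w : Fin m → Label n,
      (∏ k, c k (w k) (Fin.cons (α := fun _ => Label n) h₀ h k.castSucc) (h k)) *
      (if StripAbove σ M (Fin.cons (α := fun _ => Label n) e₀ e) (fun k => se k (w k))
        (fun k => nw k (w k)) then 1 else 0) *
      fin (Fin.cons (α := fun _ => Label n) h₀ h (Fin.last m))
        (Fin.cons (α := fun _ => Label n) e₀ e (Fin.last m)) =
      value σ fin m c se nw h₀ e₀ M := by
  induction m generalizing h₀ e₀ M with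
  | zero => simp [value, StripAbove, DiamondStrip, Fin.last]
  | succ m ih =>
    rw [value, transfer, sum_fin_succ]
    refine Finset.sum_congr rfl fun h₁ _ => ?_
    simp_rw [sum_fin_succ (α := Label n)]
    -- The sums are reordered so that the labels of the bottom row, `h₁`, `e₁` and `w₀`, come
    -- outermost.
    rw [Finset.sum_comm]
    refine Finset.sum_congr rfl fun e₁ _ => ?_
    rw [Finset.sum_congr rfl fun h _ => Finset.sum_comm, Finset.sum_comm]
    refine Finset.sum_congr rfl fun w₀ _ => ?_
    have hc : ∀ (a b : Label n) (h : Fin m → Label n) (k : Fin m),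
        Fin.cons (α := fun _ => Label n) a (Fin.cons (α := fun _ => Label n) b h) k.succ.castSucc =
          Fin.cons (α := fun _ => Label n) b h k.castSucc :=
      fun a b h k => by rw [← Fin.succ_castSucc, Fin.cons_succ]
    simp only [stripAbove_succ, Fin.prod_univ_succ, Fin.cons_zero, Fin.cons_succ, hc,
      Fin.castSucc_zero, ← Fin.succ_last]
    split_ifs with hD
    · rw [← ih, Finset.mul_sum]
      simp only [Finset.mul_sum, hD, true_and, not_false_iff, mul_assoc]
    · simp [hD]

theorem stepLeft_eq_transfer (q t : Label n) (V : Label n → Label n → Label n → S) :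
    transfer σ (fun w h h' => rightWeight σ x q h w h') (fun _ => t) (fun w => w) V =
      stepLeft σ x q t V := by
  funext h e M
  rw [transfer, Finset.sum_comm, Finset.sum_congr rfl fun e' _ => Finset.sum_comm,
    Finset.sum_comm, stepLeft]
  split_ifs with hB
  · simp [hB]
  · refine Finset.sum_congr rfl fun w _ => Finset.sum_congr rfl fun e' _ => ?_
    by_cases hD : Diamond σ e t w e'
    · simp [hB, hD, column]
    · simp [hD]

theorem stepRight_eq_transfer (q t : Label n) (V : Label n → Label n → Label n → S) :
    transfer σ (fun w h h' => rightWeight σ x w h t h') (fun w => w) (fun _ => q) V =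
      stepRight σ x q t V := by
  funext h e M
  rw [transfer, Finset.sum_comm, Finset.sum_congr rfl fun e' _ => Finset.sum_comm,
    Finset.sum_comm, stepRight]
  refine Finset.sum_congr rfl fun w _ => ?_
  split_ifs with hB
  · simp [hB]
  · refine Finset.sum_congr rfl fun e' _ => ?_
    by_cases hD : Diamond σ e w q e'
    · simp [hB, hD, column]
    · simp [hD]

/-- The value function of the first tiling. -/
noncomputable def valueLeft {m : ℕ} (q t : Fin m → Label n) (u v : Label n) :
    Label n → Label n → Label n → S :=
  value σ (fun h e => if h = v ∧ e = u then 1 else 0) m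
    (fun k w h h' => rightWeight σ x (q k) h w h') (fun k _ => t k) (fun _ w => w)

/-- The value function of the second tiling. -/
noncomputable def valueRight {m : ℕ} (q t : Fin m → Label n) (u v : Label n) :
    Label n → Label n → Label n → S :=
  value σ (fun h e => leftWeight x e h u v) m
    (fun k w h h' => rightWeight σ x w h (t k) h') (fun _ w => w) (fun k _ => q k)

theorem linked_value {m : ℕ} (q t : Fin m → Label n) {u : Label n} (hu : u = zero ∨ u = plus)
    (v : Label n) : Linked σ x (valueLeft σ x q t u v) (valueRight σ x q t u v) := by
  induction m with
  | zero => exact linked_final hu v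
  | succ m ih =>
    have := (ih (fun k => q k.succ) (fun k => t k.succ)).step (q 0) (t 0)
    rwa [← stepLeft_eq_transfer, ← stepRight_eq_transfer] at this

/-- No diamond lies below the first one; the memory `zero`, which bans nothing, stands for this. -/
theorem columnLHS_eq {m : ℕ} (q : Fin m → Label n) (r s : Label n) (t : Fin m → Label n)
    (u v : Label n) : columnLHS σ x q r s t u v =
      ∑ h, ∑ e, leftWeight x r s e h * valueLeft σ x q t u v h e zero := by
  classical
  rw [columnLHS, sum_fin_succ]
  refine Finset.sum_congr rfl fun h₀ _ => ?_
  simp_rw [sum_fin_succ (m := m) (α := Label n)]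
  rw [Finset.sum_comm]
  refine Finset.sum_congr rfl fun e₀ _ => ?_
  rw [valueLeft, ← sum_paths]
  simp only [Finset.mul_sum, stripAbove_zero, Fin.cons_zero, Fin.cons_succ, stripWeight]
  refine Finset.sum_congr rfl fun h _ => Finset.sum_congr rfl fun e _ =>
    Finset.sum_congr rfl fun w _ => ?_
  split_ifs <;> simp

theorem columnRHS_eq {m : ℕ} (q : Fin m → Label n) (r s : Label n) (t : Fin m → Label n)
    (u v : Label n) : columnRHS σ x q r s t u v = valueRight σ x q t u v s r zero := by
  classical
  rw [columnRHS, sum_fin_succ, Finset.sum_eq_single s]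
  · simp_rw [sum_fin_succ (m := m) (α := Label n)]
    rw [Finset.sum_comm, Finset.sum_eq_single r]
    · rw [valueRight, ← sum_paths]
      simp only [stripAbove_zero, Fin.cons_zero, Fin.cons_succ, stripWeight, and_self, if_true]
      refine Finset.sum_congr rfl fun h _ => Finset.sum_congr rfl fun e _ =>
        Finset.sum_congr rfl fun w _ => ?_
      ring
    · intro e₀ _ he
      simp [he]
    · simp
  · intro h₀ _ hh
    simp [hh]
  · simp

open Classical in
-- No adjacency across an edge `i⁺` is banned, so the memory is irrelevant there.
theorem valueLeft_bluePlus {m : ℕ} (q t : Fin m → Label n) (u v h : Label n) (i : Fin n)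
    (M M' : Label n) :
    valueLeft σ x q t u v h (bluePlus i) M = valueLeft σ x q t u v h (bluePlus i) M' := by
  cases m with
  | zero => rfl
  | succ m =>
    refine Finset.sum_congr rfl fun h' _ => Finset.sum_congr rfl fun e' _ =>
      Finset.sum_congr rfl fun w _ => ?_
    exact if_congr (by simp) rfl rfl

end Label

/-! ### The Column Lemma -/

theorem mainTheorem2 {n m : ℕ} {R : Type*} [CommRing R] (σ : Equiv.Perm (Fin n)) (x : R)
    (q : Fin m → Label n) (r s : Label n) (t : Fin m → Label n) (u v : Label n)
    (hr : r = Label.zero ∨ r = Label.plus) (hu : u = Label.zero ∨ u = Label.plus) :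
    columnLHS σ x q r s t u v = columnRHS σ x q r s t u v := by
  have H := Label.linked_value σ x q t hu v
  -- The bottom tile `(0, +, i⁺, i)` starts the strip with memory `zero`, whereas `plus_zero` is
  -- stated with memory `blue i`.
  have hb := fun i => Label.valueLeft_bluePlus σ x q t u v (.blue i) i .zero (.blue i)
  rw [Label.columnLHS_eq, Label.columnRHS_eq]
  generalize Label.valueLeft σ x q t u v = L at H hb ⊢
  generalize Label.valueRight σ x q t u v = V at H ⊢
  have hne := fun h h0 hp hb' b => H.right_of_ne h h0 hp hb' b ⊤
  obtain rfl | rfl := hr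
  · rcases s with _ | _ | i | i | ⟨f, g⟩ | ⟨f, g⟩ <;>
      simp [Label.sum_eq, leftWeight, Label.leftTrivial_iff, Label.leftNontrivial_iff]
    · exact H.right_zero_zero_zero.symm
    · simp only [hb, H.right_plus_zero_zero]; ring
    · exact (H.right_blue_zero_zero i).symm
    all_goals refine (hne _ ?_ ?_ ?_ false).symm <;> simp
  · rcases s with _ | _ | i | i | ⟨f, g⟩ | ⟨f, g⟩ <;>
      simp [Label.sum_eq, leftWeight, Label.leftTrivial_iff, Label.leftNontrivial_iff]
    · exact H.right_zero_plus_zero.symm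
    · exact H.right_plus_plus_zero.symm
    · exact (H.right_blue_plus_zero i).symm
    all_goals refine (hne _ ?_ ?_ ?_ true).symm <;> simp
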